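/- Let $B>0$, let $A(x)=\left(-\tfrac{Bx_2}{2},\tfrac{Bx_1}{2}\right)$ for $x=(x_1,x_2)\in\mathbb R^2$, and let $H_0=(-i\nabla-A)^2$ be the Landau Hamiltonian, self-adjoint in $L^2(\mathbb R^2)$, whose spectrum consists of the eigenvalues (Landau levels) $\lambda_q=B(2q+1)$, $q=0,1,2,\dots$. Let $P_q$ be the orthogonal projection of $L^2(\mathbb R^2)$ onto $\operatorname{Ker}(H_0-\lambda_q)$, and write $\langle x\rangle=(1+|x|^2)^{1/2}$. Let $\rho>0$ and let $V:\mathbb R^2\to\mathbb R$ be a measurable function such that, for some constant $c$, $$|V(x)|\le c\,\langle x\rangle^{-\rho},\qquad x\in\mathbb R^2 .$$ Then there exists a constant $c_\infty$, independent of $q$, such that for every $q\in\{0,1,2,\dots\}$ the operator norm in $L^2(\mathbb R^2)$ of $P_qVP_q$ (where $V$ acts by multiplication) satisfies $$\|P_qVP_q\|\le c_\infty\begin{cases}\lambda_q^{-\rho/2} & \text{if } 0<\rho<1,\\[2pt] \lambda_q^{-1/2}\,|\ln\lambda_q| & \text{if } \rho=1 \text{ and } \lambda_q\neq 1,\\[2pt]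 \lambda_q^{-1/2} & \text{if } \rho>1.\end{cases}$$ -/

import Mathlib

open MeasureTheory
open scoped SchwartzMap LineDeriv LinearPMap ENNReal

noncomputable section

namespace Landau

/-- The Euclidean plane. -/
abbrev Plane : Type := EuclideanSpace ℝ (Fin 2)

/-- The complex Hilbert space `L²(ℝ²)`, with respect to Lebesgue measure. -/
abbrev L2 : Type := Lp ℂ 2 (volume : Measure Plane)

/-- The Japanese bracket `⟨x⟩ = (1 + |x|²)^{1/2}`. -/
def bracket (x : Plane) : ℝ := Real.sqrt (1 + ‖x‖ ^ 2)

/-- The magnetic potential `A(x) = (-B x₂ / 2, B x₁ / 2)`. -/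
def vectorPotential (B : ℝ) (x : Plane) : Fin 2 → ℝ :=
  ![-(B * x 1 / 2), B * x 0 / 2]

theorem vectorPotential_hasTemperateGrowth (B : ℝ) (j : Fin 2) :
    (fun x : Plane => (vectorPotential B x j : ℂ)).HasTemperateGrowth := by
  have hcoord : ∀ i : Fin 2, (fun x : Plane => x i).HasTemperateGrowth := fun i =>
    (EuclideanSpace.proj i : Plane →L[ℝ] ℝ).hasTemperateGrowth
  have hreal : (fun x : Plane => vectorPotential B x j).HasTemperateGrowth := by
    fin_cases j
    · have h := (Function.HasTemperateGrowth.const (E := Plane) (-B / 2)).mul (hcoord 1)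
      have he : (fun x : Plane => vectorPotential B x 0) = fun x => -B / 2 * x 1 := by
        funext x
        change -(B * x 1 / 2) = -B / 2 * x 1
        ring
      exact he ▸ h
    · have h := (Function.HasTemperateGrowth.const (E := Plane) (B / 2)).mul (hcoord 0)
      have he : (fun x : Plane => vectorPotential B x 1) = fun x => B / 2 * x 0 := by
        funext x
        change B * x 0 / 2 = B / 2 * x 0
        ring
      exact he ▸ h
  exact Function.HasTemperateGrowth.comp Complex.ofRealCLM.hasTemperateGrowth hreal

/-- The component `-i ∂ⱼ - Aⱼ` of the magnetic momentum `-i∇ - A`, on Schwartz functions. -/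
def momentum (B : ℝ) (j : Fin 2) : 𝓢(Plane, ℂ) →ₗ[ℂ] 𝓢(Plane, ℂ) :=
  ((-Complex.I) • LineDeriv.lineDerivOpCLM ℂ 𝓢(Plane, ℂ) (EuclideanSpace.single j (1 : ℝ))
    - SchwartzMap.smulLeftCLM ℂ (fun x : Plane => (vectorPotential B x j : ℂ))).toLinearMap

theorem momentum_apply (B : ℝ) (j : Fin 2) (f : 𝓢(Plane, ℂ)) (x : Plane) :
    momentum B j f x =
      -Complex.I * lineDeriv ℝ f x (EuclideanSpace.single j 1) - vectorPotential B x j * f x := by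
  simp [momentum, SchwartzMap.smulLeftCLM_apply_apply (vectorPotential_hasTemperateGrowth B j),
    SchwartzMap.lineDerivOp_apply]

/-- The differential expression `(-i∇ - A)²`, on Schwartz functions. -/
def landauSchwartz (B : ℝ) : 𝓢(Plane, ℂ) →ₗ[ℂ] 𝓢(Plane, ℂ) :=
  momentum B 0 ∘ₗ momentum B 0 + momentum B 1 ∘ₗ momentum B 1

/-- The inclusion of the Schwartz space into `L²(ℝ²)`. -/
def schwartzToL2 : 𝓢(Plane, ℂ) →ₗ[ℂ] L2 :=
  (SchwartzMap.toLpCLM ℂ ℂ 2 (volume : Measure Plane)).toLinearMap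

theorem schwartzToL2_injective : Function.Injective schwartzToL2 :=
  SchwartzMap.injective_toLp 2 (volume : Measure Plane)

/-- The operator `(-i∇ - A)²` in `L²(ℝ²)` with domain the Schwartz space. -/
def landauCore (B : ℝ) : L2 →ₗ.[ℂ] L2 where
  domain := LinearMap.range schwartzToL2
  toFun := schwartzToL2 ∘ₗ landauSchwartz B ∘ₗ
    (LinearEquiv.ofInjective schwartzToL2 schwartzToL2_injective).symm.toLinearMap

theorem landauCore_apply (B : ℝ) (f : 𝓢(Plane, ℂ)) :
    landauCore B ⟨schwartzToL2 f, f, rfl⟩ = schwartzToL2 (landauSchwartz B f) := by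
  have h : (LinearEquiv.ofInjective schwartzToL2 schwartzToL2_injective).symm
      ⟨schwartzToL2 f, f, rfl⟩ = f :=
    (LinearEquiv.symm_apply_eq _).2 rfl
  exact congrArg (fun g => schwartzToL2 (landauSchwartz B g)) h

theorem landauCore_dense (B : ℝ) : Dense ((landauCore B).domain : Set L2) :=
  SchwartzMap.denseRange_toLpCLM (E := Plane) (F := ℂ) (p := 2) (μ := volume) (by simp)

/-- The Landau Hamiltonian `H₀ = (-i∇ - A)²`, self-adjoint in `L²(ℝ²)`. The operator
`(-i∇ - A)²` on the Schwartz space is essentially self-adjoint, so its unique self-adjoint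
extension is its adjoint: the domain consists of the `u ∈ L²(ℝ²)` for which the
distribution `(-i∇ - A)² u` belongs to `L²(ℝ²)`. -/
def hamiltonian (B : ℝ) : L2 →ₗ.[ℂ] L2 := (landauCore B)†

/-- The Landau level `λ_q = B (2q + 1)`. -/
def level (B : ℝ) (q : ℕ) : ℝ := B * (2 * q + 1)

/-- The kernel `Ker (H₀ - λ_q)`: the `u` in the domain of `H₀` with `H₀ u = λ_q u`, that is,
those for which `(u, λ_q u)` lies on the graph of `H₀`. -/
def levelSpace (B : ℝ) (q : ℕ) : Submodule ℂ L2 :=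
  (hamiltonian B).graph.comap
    (LinearMap.id.prod ((level B q : ℂ) • (LinearMap.id : L2 →ₗ[ℂ] L2)))

theorem mem_levelSpace_iff (B : ℝ) (q : ℕ) (u : L2) :
    u ∈ levelSpace B q ↔
      ∃ h : u ∈ (hamiltonian B).domain, hamiltonian B ⟨u, h⟩ = (level B q : ℂ) • u := by
  change (u, (level B q : ℂ) • u) ∈ (hamiltonian B).graph ↔ _
  rw [LinearPMap.mem_graph_iff]
  constructor
  · rintro ⟨y, rfl, hy⟩
    exact ⟨y.2, hy⟩
  · rintro ⟨h, hu⟩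
    exact ⟨⟨u, h⟩, rfl, hu⟩

theorem levelSpace_isClosed (B : ℝ) (q : ℕ) : IsClosed (levelSpace B q : Set L2) := by
  have h : IsClosed ((hamiltonian B).graph : Set (L2 × L2)) :=
    LinearPMap.adjoint_isClosed (landauCore_dense B)
  exact h.preimage (f := fun u : L2 => (u, (level B q : ℂ) • u)) (by fun_prop)

instance (B : ℝ) (q : ℕ) : (levelSpace B q).HasOrthogonalProjection :=
  haveI : CompleteSpace (levelSpace B q) := (levelSpace_isClosed B q).completeSpace_coe
  inferInstance

/-- The orthogonal projection `P_q` of `L²(ℝ²)` onto `Ker (H₀ - λ_q)`. -/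
def levelProj (B : ℝ) (q : ℕ) : L2 →L[ℂ] L2 := (levelSpace B q).starProjection

/-- The operator of multiplication by a bounded function `V` in `L²(ℝ²)`. -/
def mulOp (V : Plane → ℝ) (hV : MemLp (fun x => (V x : ℂ)) ∞ (volume : Measure Plane)) :
    L2 →L[ℂ] L2 :=
  (ContinuousLinearMap.mul ℂ ℂ).holderL (volume : Measure Plane) ∞ 2 2 (hV.toLp _)

theorem mulOp_ae (V : Plane → ℝ) (hV : MemLp (fun x => (V x : ℂ)) ∞ (volume : Measure Plane))
    (u : L2) : (mulOp V hV u : Plane → ℂ) =ᵐ[volume] fun x => (V x : ℂ) * u x := by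
  have h := (ContinuousLinearMap.mul ℂ ℂ).coeFn_holder (r := 2) (hV.toLp _) u
  filter_upwards [h, hV.coeFn_toLp] with x hx hx'
  rw [← hx', mulOp, ContinuousLinearMap.holderL_apply_apply, hx]
  rfl

/-- A measurable function with `|V(x)| ≤ c ⟨x⟩^{-ρ}`, `ρ > 0`, is bounded. -/
theorem memLp_top_of_decay {V : Plane → ℝ} (hV : Measurable V) {c ρ : ℝ} (hρ : 0 < ρ)
    (hdecay : ∀ x, |V x| ≤ c * bracket x ^ (-ρ)) :
    MemLp (fun x => (V x : ℂ)) ∞ (volume : Measure Plane) := by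
  have hb : ∀ x, 1 ≤ bracket x := fun x =>
    Real.one_le_sqrt.2 (by nlinarith [sq_nonneg ‖x‖])
  refine memLp_top_of_bound (Complex.measurable_ofReal.comp hV).aestronglyMeasurable |c|
    (Filter.Eventually.of_forall fun x => ?_)
  have h0 : 0 ≤ bracket x ^ (-ρ) := Real.rpow_nonneg (zero_le_one.trans (hb x)) _
  have h1 : bracket x ^ (-ρ) ≤ 1 := Real.rpow_le_one_of_one_le_of_nonpos (hb x) (by linarith)
  simp only [Complex.norm_real, Real.norm_eq_abs]
  calc |V x| ≤ c * bracket x ^ (-ρ) := hdecay x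
    _ ≤ |c| * bracket x ^ (-ρ) := mul_le_mul_of_nonneg_right (le_abs_self c) h0
    _ ≤ |c| := mul_le_of_le_one_right (abs_nonneg c) h1

/-- The Berezin–Toeplitz operator `P_q V P_q`. -/
def toeplitz (B : ℝ) (q : ℕ) (V : Plane → ℝ)
    (hV : MemLp (fun x => (V x : ℂ)) ∞ (volume : Measure Plane)) : L2 →L[ℂ] L2 :=
  levelProj B q ∘L mulOp V hV ∘L levelProj B q

end Landau

end

/-!
The bound is a quantum version of the fact that a charged particle of energy `λ` moves on a circle
of radius of the order of `λ^{1/2}`, hence spends at most a fraction of the order of `R λ^{-1/2}`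
of its time in a disc of radius `R`. The corresponding statement for an eigenfunction `u` of the
level `λ = λ_q` is

  `∫ (1 + |x|²/R²)^{-3/2} |u|² ≤ (2BR + 9/R) λ^{-1/2} ‖u‖²`        (`levelSpace_disc_mass_le`),

and it is proved by a virial argument. With `π_j = -i∂_j - A_j`, `f` a bounded function of the
coordinate `x_j` alone, `w = f'` and `k ≠ j`, the expectation of `[H₀, f π_j]` in an eigenfunction
vanishes, which expresses `∫ w (|π_j u|² - |π_k u|² + λ|u|²)` through the magnetic term
`B ⟨π_k u, f u⟩` (`virial_identity`); the energy identity localized by `w` gives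
`∫ w (|π_j u|² + |π_k u|² - λ|u|²)` up to a term with `w'` (`energy_identity`). The sum controls
`∫ w |π_j u|²` by `R λ^{1/2}`, for both `j`, and the energy identity localized to the disc turns
this into a bound for `λ ∫ |u|²` over the disc (`disc_mass_le`). Since `f` is of size `R` and
`‖π_k u‖ ≤ λ^{1/2} ‖u‖`, nothing depends on `q` except through `λ`.

These computations need Schwartz functions, while an eigenfunction is a priori only an `L²`
function with `H₀ u = λ u` in the sense of the adjoint. It is a limit of Schwartz functions in the
graph norm (`exists_seq_of_mem_levelSpace`) because `H₀ ≥ B` and `H₀` maps the Schwartz space onto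
a dense subspace: on the functions `z^a z̄^b e^{-B|x|²/4}` it is triangular with non-zero diagonal
(`monomialS_mem_range`), and these functions are total in `L²`
(`eq_zero_of_orthogonal_monomialS`).

Finally `⟨x⟩^{-ρ}` is dominated by a sum over dyadic discs up to the radius `λ^{1/2}`
(`bracket_rpow_le`), so that `∫ ⟨x⟩^{-ρ} |u|²` is bounded by
`λ^{-ρ/2} + λ^{-1/2} ∑ 2^{k(1-ρ)}`, the sum being over `2^k ≲ λ^{1/2}`; the three cases of the
theorem are the three behaviours of this geometric sum. The Cauchy–Schwarz inequality passes from
the weighted mass to the norm of `P_q V P_q` (`norm_toeplitz_le`).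
-/

noncomputable section

namespace Landau

/-! ### Differential calculus of the magnetic momenta on Schwartz functions -/

/-- Multiplication of a Schwartz function by a scalar function; it is the pointwise product as
soon as the factor has temperate growth. -/
abbrev smulS (g : Plane → ℂ) : 𝓢(Plane, ℂ) →L[ℂ] 𝓢(Plane, ℂ) := SchwartzMap.smulLeftCLM ℂ g

/-- The `j`-th partial derivative of a Schwartz function. -/
abbrev partialS (j : Fin 2) : 𝓢(Plane, ℂ) →L[ℂ] 𝓢(Plane, ℂ) :=
  LineDeriv.lineDerivOpCLM ℂ 𝓢(Plane, ℂ) (EuclideanSpace.single j (1 : ℝ) : Plane)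

theorem smulS_apply {g : Plane → ℂ} (hg : g.HasTemperateGrowth) (φ : 𝓢(Plane, ℂ)) (x : Plane) :
    smulS g φ x = g x * φ x := by
  simp [SchwartzMap.smulLeftCLM_apply_apply hg]

theorem partialS_apply (j : Fin 2) (φ : 𝓢(Plane, ℂ)) (x : Plane) :
    partialS j φ x = fderiv ℝ φ x (EuclideanSpace.single j 1) :=
  SchwartzMap.lineDerivOp_apply_eq_fderiv _ φ x

theorem hasTemperateGrowth_ofReal_comp {g : Plane → ℝ} (hg : g.HasTemperateGrowth) :
    (fun x => (g x : ℂ)).HasTemperateGrowth :=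
  Function.HasTemperateGrowth.comp Complex.ofRealCLM.hasTemperateGrowth hg

/-- `g` is differentiable and its `j`-th partial derivative is `g'`. -/
def HasPartial (j : Fin 2) (g g' : Plane → ℂ) : Prop :=
  ∀ x, DifferentiableAt ℝ g x ∧ fderiv ℝ g x (EuclideanSpace.single j 1) = g' x

theorem HasPartial.mul {j : Fin 2} {g g' h h' : Plane → ℂ} (hg : HasPartial j g g')
    (hh : HasPartial j h h') : HasPartial j (fun x => g x * h x)
      (fun x => g' x * h x + g x * h' x) := fun x => by
  refine ⟨(hg x).1.mul (hh x).1, ?_⟩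
  rw [fderiv_fun_mul (hg x).1 (hh x).1]
  simp only [add_apply, smul_apply, (hg x).2, (hh x).2, smul_eq_mul]
  ring

theorem partialS_smulS (j : Fin 2) {g g' : Plane → ℂ} (hg : g.HasTemperateGrowth)
    (hg' : g'.HasTemperateGrowth) (h : HasPartial j g g') (φ : 𝓢(Plane, ℂ)) :
    partialS j (smulS g φ) = smulS g' φ + smulS g (partialS j φ) := by
  ext x
  have h0 : HasPartial j φ (partialS j φ) := fun x =>
    ⟨φ.differentiableAt, (partialS_apply j φ x).symm⟩
  have h1 := (h.mul h0) x
  have h2 : (smulS g φ : Plane → ℂ) = fun x => g x * φ x := funext (smulS_apply hg φ)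
  rw [partialS_apply, h2, h1.2, add_apply, smulS_apply hg, smulS_apply hg']

theorem momentum_eq (B : ℝ) (j : Fin 2) (φ : 𝓢(Plane, ℂ)) :
    momentum B j φ = (-Complex.I) • partialS j φ
      - smulS (fun x => (vectorPotential B x j : ℂ)) φ := rfl

theorem smulS_comm {g h : Plane → ℂ} (hg : g.HasTemperateGrowth) (hh : h.HasTemperateGrowth)
    (φ : 𝓢(Plane, ℂ)) : smulS g (smulS h φ) = smulS h (smulS g φ) := by
  ext x
  rw [smulS_apply hg, smulS_apply hh, smulS_apply hh, smulS_apply hg]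
  ring

theorem momentum_smulS (B : ℝ) (j : Fin 2) {g g' : Plane → ℂ} (hg : g.HasTemperateGrowth)
    (hg' : g'.HasTemperateGrowth) (h : HasPartial j g g') (φ : 𝓢(Plane, ℂ)) :
    momentum B j (smulS g φ) = smulS g (momentum B j φ) - Complex.I • smulS g' φ := by
  rw [momentum_eq, momentum_eq, partialS_smulS j hg hg' h,
    smulS_comm (vectorPotential_hasTemperateGrowth B j) hg, map_sub, map_smul]
  module

theorem partialS_comm (j k : Fin 2) (φ : 𝓢(Plane, ℂ)) :
    partialS j (partialS k φ) = partialS k (partialS j φ) := by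
  ext x
  have key : ∀ j k, partialS j (partialS k φ) x = fderiv ℝ (fderiv ℝ φ) x
      (EuclideanSpace.single j 1) (EuclideanSpace.single k 1) := by
    intro j k
    have h : (partialS k φ : Plane → ℂ) = fun y => fderiv ℝ φ y (EuclideanSpace.single k 1) :=
      funext fun y => partialS_apply k φ y
    have hd : DifferentiableAt ℝ (fderiv ℝ φ) x :=
      ((φ.smooth 2).fderiv_right (m := 1) (by norm_num)).differentiable (by norm_num) x
    rw [partialS_apply, h, fderiv_clm_apply hd (by fun_prop)]
    simp
  rw [key, key]
  exact ((φ.smooth 2).contDiffAt.isSymmSndFDerivAt (by simp)) _ _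

theorem hasPartial_ofReal (j : Fin 2) {g g' : Plane → ℝ} (hd : Differentiable ℝ g)
    (h : ∀ x, fderiv ℝ g x (EuclideanSpace.single j 1) = g' x) :
    HasPartial j (fun x => (g x : ℂ)) (fun x => (g' x : ℂ)) := fun x => by
  have h1 : HasFDerivAt (fun x => (g x : ℂ)) (Complex.ofRealCLM ∘L fderiv ℝ g x) x :=
    Complex.ofRealCLM.hasFDerivAt.comp x (hd x).hasFDerivAt
  refine ⟨h1.differentiableAt, ?_⟩
  rw [h1.fderiv]
  simp [h]

theorem hasPartial_linear (j : Fin 2) (L : Plane →L[ℝ] ℂ) :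
    HasPartial j L (fun _ => L (EuclideanSpace.single j 1)) := fun x => by
  refine ⟨L.differentiableAt, ?_⟩
  rw [L.fderiv]

theorem smulS_const (a : ℂ) (φ : 𝓢(Plane, ℂ)) : smulS (fun _ => a) φ = a • φ := by
  ext x
  rw [smulS_apply (Function.HasTemperateGrowth.const a)]; simp

/-- The canonical commutation relation `[π₁, π₂] = iB`. -/
theorem momentum_commutator (B : ℝ) (φ : 𝓢(Plane, ℂ)) :
    momentum B 0 (momentum B 1 φ) - momentum B 1 (momentum B 0 φ) = (Complex.I * B) • φ := by
  have hA := vectorPotential_hasTemperateGrowth B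
  have p0 : partialS 0 (smulS (fun x => (vectorPotential B x 1 : ℂ)) φ) =
      (B / 2 : ℂ) • φ + smulS (fun x => (vectorPotential B x 1 : ℂ)) (partialS 0 φ) := by
    rw [← smulS_const]
    refine partialS_smulS 0 (hA 1) (Function.HasTemperateGrowth.const _) ?_ φ
    have := hasPartial_linear 0 ((B / 2 : ℝ) • Complex.ofRealCLM ∘L
      (EuclideanSpace.proj 0 : Plane →L[ℝ] ℝ))
    convert! this using 2 with x x
    · simp [vectorPotential]; ring
    · simp
  have p1 : partialS 1 (smulS (fun x => (vectorPotential B x 0 : ℂ)) φ) =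
      (-B / 2 : ℂ) • φ + smulS (fun x => (vectorPotential B x 0 : ℂ)) (partialS 1 φ) := by
    rw [← smulS_const]
    refine partialS_smulS 1 (hA 0) (Function.HasTemperateGrowth.const _) ?_ φ
    have := hasPartial_linear 1 ((-B / 2 : ℝ) • Complex.ofRealCLM ∘L
      (EuclideanSpace.proj 1 : Plane →L[ℝ] ℝ))
    convert! this using 2 with x x
    · simp [vectorPotential]; ring
    · simp
  simp only [momentum_eq, map_sub, map_smul, p0, p1, smulS_comm (hA 0) (hA 1), partialS_comm 0 1]
  module

theorem inner_schwartzToL2 (φ ψ : 𝓢(Plane, ℂ)) :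
    inner ℂ (schwartzToL2 φ) (schwartzToL2 ψ) = ∫ x, inner ℂ (φ x) (ψ x) :=
  SchwartzMap.inner_toL2_toL2_eq φ ψ

theorem coeFn_schwartzToL2 (φ : 𝓢(Plane, ℂ)) : (schwartzToL2 φ : Plane → ℂ) =ᵐ[volume] φ :=
  φ.coeFn_toLp 2

theorem inner_smulS {g : Plane → ℝ} (hg : g.HasTemperateGrowth) (φ ψ : 𝓢(Plane, ℂ)) :
    inner ℂ (schwartzToL2 (smulS (fun x => (g x : ℂ)) φ)) (schwartzToL2 ψ) =
      inner ℂ (schwartzToL2 φ) (schwartzToL2 (smulS (fun x => (g x : ℂ)) ψ)) := by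
  rw [inner_schwartzToL2, inner_schwartzToL2]
  congr with x
  rw [smulS_apply (hasTemperateGrowth_ofReal_comp hg),
    smulS_apply (hasTemperateGrowth_ofReal_comp hg)]
  simp
  ring

/-- The components of the magnetic momentum are symmetric. -/
theorem inner_momentum (B : ℝ) (j : Fin 2) (φ ψ : 𝓢(Plane, ℂ)) :
    inner ℂ (schwartzToL2 (momentum B j φ)) (schwartzToL2 ψ) =
      inner ℂ (schwartzToL2 φ) (schwartzToL2 (momentum B j ψ)) := by
  have hA : Function.HasTemperateGrowth (fun x : Plane => vectorPotential B x j) := by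
    have := (Complex.reCLM.hasTemperateGrowth).comp (vectorPotential_hasTemperateGrowth B j)
    exact this
  have hp : inner ℂ (schwartzToL2 φ) (schwartzToL2 (partialS j ψ)) =
      - inner ℂ (schwartzToL2 (partialS j φ)) (schwartzToL2 ψ) := by
    rw [inner_schwartzToL2, inner_schwartzToL2]
    have h := SchwartzMap.integral_bilinear_lineDerivOp_right_eq_neg_left (μ := volume) φ ψ
      (ContinuousLinearMap.mul ℝ ℂ ∘L Complex.conjCLE.toContinuousLinearMap)
      (EuclideanSpace.single j (1 : ℝ))
    simpa [mul_comm] using h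
  simp only [momentum_eq, map_sub, map_smul, inner_sub_left, inner_sub_right, inner_smul_left,
    inner_smul_right, hp, inner_smulS hA]
  simp

theorem norm_smulS_le {g : Plane → ℂ} (hg : g.HasTemperateGrowth) {M : ℝ} (hM : ∀ x, ‖g x‖ ≤ M)
    (φ : 𝓢(Plane, ℂ)) : ‖schwartzToL2 (smulS g φ)‖ ≤ M * ‖schwartzToL2 φ‖ := by
  refine Lp.norm_le_mul_norm_of_ae_le_mul ?_
  filter_upwards [coeFn_schwartzToL2 φ, coeFn_schwartzToL2 (smulS g φ)] with x h1 h2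
  rw [h1, h2, smulS_apply hg, norm_mul]
  exact mul_le_mul_of_nonneg_right (hM x) (norm_nonneg _)

/-! ### Commutator identities for the Landau Hamiltonian -/

/-- The `L²` inner product of two Schwartz functions. -/
abbrev ip (φ ψ : 𝓢(Plane, ℂ)) : ℂ := inner ℂ (schwartzToL2 φ) (schwartzToL2 ψ)

/-- Multiplication of a Schwartz function by a real function. -/
abbrev smulR (g : Plane → ℝ) : 𝓢(Plane, ℂ) →L[ℂ] 𝓢(Plane, ℂ) := smulS fun x => (g x : ℂ)

theorem ip_conj (φ ψ : 𝓢(Plane, ℂ)) : (starRingEnd ℂ) (ip φ ψ) = ip ψ φ := inner_conj_symm _ _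

theorem norm_ip_le (φ ψ : 𝓢(Plane, ℂ)) : ‖ip φ ψ‖ ≤ ‖schwartzToL2 φ‖ * ‖schwartzToL2 ψ‖ :=
  norm_inner_le_norm _ _

theorem ip_smulR {g : Plane → ℝ} (hg : g.HasTemperateGrowth) (φ ψ : 𝓢(Plane, ℂ)) :
    ip (smulR g φ) ψ = ip φ (smulR g ψ) := inner_smulS hg φ ψ

theorem ip_momentum (B : ℝ) (j : Fin 2) (φ ψ : 𝓢(Plane, ℂ)) :
    ip (momentum B j φ) ψ = ip φ (momentum B j ψ) := inner_momentum B j φ ψ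

/-- The real function `g` has temperate growth, and its `j`-th partial derivative is the
function `g'`, also of temperate growth. -/
structure TemperatePartial (j : Fin 2) (g g' : Plane → ℝ) : Prop where
  growth : g.HasTemperateGrowth
  growth' : g'.HasTemperateGrowth
  differentiable : Differentiable ℝ g
  fderiv_eq : ∀ x, fderiv ℝ g x (EuclideanSpace.single j 1) = g' x

theorem TemperatePartial.momentum_smulR {j : Fin 2} {g g' : Plane → ℝ}
    (h : TemperatePartial j g g') (B : ℝ) (φ : 𝓢(Plane, ℂ)) :
    momentum B j (smulR g φ) = smulR g (momentum B j φ) - Complex.I • smulR g' φ :=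
  momentum_smulS B j (hasTemperateGrowth_ofReal_comp h.growth)
    (hasTemperateGrowth_ofReal_comp h.growth') (hasPartial_ofReal j h.differentiable h.fderiv_eq) φ

/-- The imaginary part of `⟨π_j φ, f φ⟩` is the expectation of the commutator `[π_j, f]`. -/
theorem TemperatePartial.two_im_ip {j : Fin 2} {f w : Plane → ℝ}
    (h : TemperatePartial j f w) (B : ℝ) (φ : 𝓢(Plane, ℂ)) :
    2 * (ip (momentum B j φ) (smulR f φ)).im = -(ip φ (smulR w φ)).re := by
  have h1 : ip (momentum B j φ) (smulR f φ) =
      (starRingEnd ℂ) (ip (momentum B j φ) (smulR f φ)) - Complex.I * ip φ (smulR w φ) := by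
    rw [ip_conj, ip_smulR h.growth, ip_momentum, h.momentum_smulR]
    simp only [ip, map_sub, map_smul, inner_sub_right, inner_smul_right]
  have h2 := congrArg Complex.im h1
  simp only [Complex.sub_im, Complex.mul_im, Complex.conj_im, Complex.I_re, Complex.I_im] at h2
  linarith

/-- The commutation relation for the two momenta in either order, with the sign kept in `β`. -/
theorem exists_momentum_commutator (B : ℝ) {j k : Fin 2} (hjk : j ≠ k) :
    ∃ β : ℝ, |β| = |B| ∧ ∀ φ : 𝓢(Plane, ℂ), momentum B k (momentum B j φ) =
      momentum B j (momentum B k φ) - (Complex.I * β) • φ := by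
  have h01 : (j = 0 ∧ k = 1) ∨ (j = 1 ∧ k = 0) := by fin_cases j <;> fin_cases k <;> simp_all
  rcases h01 with ⟨rfl, rfl⟩ | ⟨rfl, rfl⟩
  · exact ⟨B, rfl, fun φ => by rw [← momentum_commutator]; abel⟩
  · refine ⟨-B, abs_neg B, fun φ => ?_⟩
    rw [Complex.ofReal_neg, mul_neg, neg_smul, ← momentum_commutator]; abel

theorem landauSchwartz_eq (B : ℝ) {j k : Fin 2} (hjk : j ≠ k) (φ : 𝓢(Plane, ℂ)) :
    landauSchwartz B φ = momentum B j (momentum B j φ) + momentum B k (momentum B k φ) := by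
  have h01 : (j = 0 ∧ k = 1) ∨ (j = 1 ∧ k = 0) := by fin_cases j <;> fin_cases k <;> simp_all
  rcases h01 with ⟨rfl, rfl⟩ | ⟨rfl, rfl⟩
  · rfl
  · exact add_comm _ _

/-- The virial identity: the expectation in `φ` of the commutator of `(-i∇ - A)² - t` with
`f π_j`, where `f` depends on the `j`-th coordinate only and `w` is its derivative. -/
theorem virial_identity (B : ℝ) {j k : Fin 2} (hjk : j ≠ k) {f w : Plane → ℝ}
    (hj : TemperatePartial j f w) (hk : TemperatePartial k f (fun _ => 0)) (t : ℝ)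
    {β : ℝ} (hβ : ∀ φ : 𝓢(Plane, ℂ), momentum B k (momentum B j φ) =
      momentum B j (momentum B k φ) - (Complex.I * β) • φ) (φ : 𝓢(Plane, ℂ)) :
    (ip (momentum B j φ) (smulR w (momentum B j φ))).re
      - (ip (momentum B k φ) (smulR w (momentum B k φ))).re + t * (ip φ (smulR w φ)).re =
    -2 * (ip (landauSchwartz B φ - (t : ℂ) • φ) (smulR f (momentum B j φ))).im
      - 2 * β * (ip (momentum B k φ) (smulR f φ)).re := by
  have h1 := hj.two_im_ip B φ
  have h2 := hj.two_im_ip B (momentum B j φ)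
  have h3 := hj.two_im_ip B (momentum B k φ)
  have e1 : ip (momentum B k (momentum B k φ)) (smulR f (momentum B j φ)) =
      (starRingEnd ℂ) (ip (momentum B j (momentum B k φ)) (smulR f (momentum B k φ)))
        - Complex.I * β * ip (momentum B k φ) (smulR f φ) := by
    have hz : ∀ ψ, smulR (fun _ => 0) ψ = 0 := fun ψ => by
      ext x
      rw [smulS_apply (hasTemperateGrowth_ofReal_comp hk.growth')]
      simp
    rw [ip_conj, ip_smulR hj.growth, ip_momentum, hk.momentum_smulR, hβ, hz]
    simp only [ip, map_sub, map_smul, inner_sub_right, inner_smul_right, smul_zero, sub_zero]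
  have e2 : ip φ (smulR f (momentum B j φ)) =
      (starRingEnd ℂ) (ip (momentum B j φ) (smulR f φ)) := by
    rw [ip_conj, ip_smulR hj.growth]
  have e3 : ip (landauSchwartz B φ - (t : ℂ) • φ) (smulR f (momentum B j φ)) =
      ip (momentum B j (momentum B j φ)) (smulR f (momentum B j φ))
      + ip (momentum B k (momentum B k φ)) (smulR f (momentum B j φ))
      - t * ip φ (smulR f (momentum B j φ)) := by
    rw [landauSchwartz_eq B hjk]
    simp only [ip, map_sub, map_add, map_smul, inner_sub_left, inner_add_left, inner_smul_left,
      Complex.conj_ofReal]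
  rw [e3, e1, e2]
  simp only [Complex.sub_im, Complex.add_im, Complex.mul_im, Complex.conj_im, Complex.conj_re,
    Complex.mul_re, Complex.I_re, Complex.I_im, Complex.ofReal_re, Complex.ofReal_im]
  linear_combination t * h1 + h2 - h3

/-- The localized energy identity: `∫ g |πφ|²` against `∫ g |φ|²`. -/
theorem energy_identity (B : ℝ) {g g₀ g₁ : Plane → ℝ}
    (h0 : TemperatePartial 0 g g₀) (h1 : TemperatePartial 1 g g₁) (t : ℝ) (φ : 𝓢(Plane, ℂ)) :
    (ip (momentum B 0 φ) (smulR g (momentum B 0 φ))).re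
      + (ip (momentum B 1 φ) (smulR g (momentum B 1 φ))).re - t * (ip φ (smulR g φ)).re =
    (ip (landauSchwartz B φ - (t : ℂ) • φ) (smulR g φ)).re
      - (ip (momentum B 0 φ) (smulR g₀ φ)).im - (ip (momentum B 1 φ) (smulR g₁ φ)).im := by
  have e : ∀ {j : Fin 2} {g' : Plane → ℝ}, TemperatePartial j g g' →
      ip (momentum B j φ) (smulR g (momentum B j φ)) =
        ip (momentum B j (momentum B j φ)) (smulR g φ)
          + Complex.I * ip (momentum B j φ) (smulR g' φ) := by
    intro j g' h
    rw [ip_momentum B j (momentum B j φ), h.momentum_smulR]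
    simp only [ip, map_sub, map_smul, inner_sub_right, inner_smul_right]
    ring
  have e3 : ip (landauSchwartz B φ - (t : ℂ) • φ) (smulR g φ) =
      ip (momentum B 0 (momentum B 0 φ)) (smulR g φ)
      + ip (momentum B 1 (momentum B 1 φ)) (smulR g φ) - t * ip φ (smulR g φ) := by
    rw [landauSchwartz_eq B zero_ne_one]
    simp only [ip, map_sub, map_add, map_smul, inner_sub_left, inner_add_left, inner_smul_left,
      Complex.conj_ofReal]
  rw [e3, e h0, e h1]
  simp
  ring

theorem re_ip_landauSchwartz (B : ℝ) (φ : 𝓢(Plane, ℂ)) :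
    (ip (landauSchwartz B φ) φ).re =
      ‖schwartzToL2 (momentum B 0 φ)‖ ^ 2 + ‖schwartzToL2 (momentum B 1 φ)‖ ^ 2 := by
  have h : ip (landauSchwartz B φ) φ =
      ip (momentum B 0 φ) (momentum B 0 φ) + ip (momentum B 1 φ) (momentum B 1 φ) := by
    rw [← ip_momentum, ← ip_momentum, landauSchwartz_eq B zero_ne_one]
    simp only [ip, map_add, inner_add_left]
  rw [h, Complex.add_re]
  simp only [ip, inner_self_eq_norm_sq_to_K]
  norm_cast

/-- The Landau Hamiltonian is symmetric on Schwartz functions. -/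
theorem ip_landauSchwartz (B : ℝ) (φ ψ : 𝓢(Plane, ℂ)) :
    ip (landauSchwartz B φ) ψ = ip φ (landauSchwartz B ψ) := by
  rw [landauSchwartz_eq B zero_ne_one, landauSchwartz_eq B zero_ne_one]
  simp only [ip, map_add, inner_add_left, inner_add_right]
  simp only [inner_momentum]

/-- The lower bound `H₀ ≥ B` on Schwartz functions, from the commutation relation. -/
theorem le_re_ip_landauSchwartz {B : ℝ} (φ : 𝓢(Plane, ℂ)) :
    B * ‖schwartzToL2 φ‖ ^ 2 ≤ (ip (landauSchwartz B φ) φ).re := by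
  have h : ip (momentum B 1 φ) (momentum B 0 φ) = 
      (starRingEnd ℂ) (ip (momentum B 1 φ) (momentum B 0 φ)) - Complex.I * B * ip φ φ := by
    rw [ip_conj, ip_momentum, ip_momentum]
    have := momentum_commutator B φ
    rw [sub_eq_iff_eq_add'] at this
    rw [this]
    simp only [ip, map_add, map_smul, inner_add_right, inner_smul_right]
    ring
  have h2 := congrArg Complex.im h
  have h3 : ip φ φ = (‖schwartzToL2 φ‖ ^ 2 : ℝ) := by
    simp only [ip, inner_self_eq_norm_sq_to_K]; norm_cast
  rw [h3] at h2
  simp only [Complex.sub_im, Complex.mul_im, Complex.conj_im, 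
    Complex.mul_re, Complex.I_re, Complex.I_im, Complex.ofReal_re, Complex.ofReal_im] at h2
  have h4 := (Complex.abs_im_le_norm _).trans (norm_ip_le (momentum B 1 φ) (momentum B 0 φ))
  rw [re_ip_landauSchwartz]
  have h5 := neg_le_of_abs_le h4
  nlinarith [sq_nonneg (‖schwartzToL2 (momentum B 0 φ)‖ - ‖schwartzToL2 (momentum B 1 φ)‖)]

theorem abs_ip_smulR_le {g : Plane → ℝ} (hg : g.HasTemperateGrowth) {M : ℝ}
    (hM : ∀ x, |g x| ≤ M) (φ ψ : 𝓢(Plane, ℂ)) :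
    ‖ip φ (smulR g ψ)‖ ≤ M * (‖schwartzToL2 φ‖ * ‖schwartzToL2 ψ‖) := by
  have h := norm_smulS_le (hasTemperateGrowth_ofReal_comp hg) (M := M)
    (fun x => by simpa using hM x) ψ
  calc _ ≤ _ := norm_ip_le _ _
    _ ≤ ‖schwartzToL2 φ‖ * (M * ‖schwartzToL2 ψ‖) := by gcongr
    _ = _ := by ring

theorem re_ip_smulR {g : Plane → ℝ} (hg : g.HasTemperateGrowth) (φ : 𝓢(Plane, ℂ)) :
    (ip φ (smulR g φ)).re = ∫ x, g x * ‖φ x‖ ^ 2 := by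
  have h : ip φ (smulR g φ) = ∫ x, ((g x * ‖φ x‖ ^ 2 : ℝ) : ℂ) := by
    rw [ip, inner_schwartzToL2]
    congr with x
    rw [smulS_apply (hasTemperateGrowth_ofReal_comp hg)]
    simp only [RCLike.inner_apply]
    rw [mul_assoc, RCLike.mul_conj]
    push_cast
    rfl
  rw [h, integral_complex_ofReal, Complex.ofReal_re]

theorem integrable_smulR {g : Plane → ℝ} (hg : g.HasTemperateGrowth) (φ : 𝓢(Plane, ℂ)) :
    Integrable (fun x => g x * ‖φ x‖ ^ 2) := by
  have h := ((L2.integrable_inner (𝕜 := ℂ) (schwartzToL2 φ) (schwartzToL2 (smulR g φ)))).norm.congr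
    (g := fun x => ‖g x * ‖φ x‖ ^ 2‖) ?_
  · refine (integrable_norm_iff ?_).1 h
    exact (hg.1.continuous.mul (φ.continuous.norm.pow 2)).aestronglyMeasurable
  · filter_upwards [coeFn_schwartzToL2 φ, coeFn_schwartzToL2 (smulR g φ)] with x h1 h2
    rw [h1, h2, smulS_apply (hasTemperateGrowth_ofReal_comp hg)]
    simp
    ring

theorem re_ip_smulR_mono {g h : Plane → ℝ} (hg : g.HasTemperateGrowth)
    (hh : h.HasTemperateGrowth) (hgh : ∀ x, g x ≤ h x) (φ : 𝓢(Plane, ℂ)) :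
    (ip φ (smulR g φ)).re ≤ (ip φ (smulR h φ)).re := by
  rw [re_ip_smulR hg, re_ip_smulR hh]
  exact integral_mono (integrable_smulR hg φ) (integrable_smulR hh φ) fun x =>
    mul_le_mul_of_nonneg_right (hgh x) (sq_nonneg _)

/-! ### Weights, and the local estimate for Schwartz functions -/

section Weights

variable {H : Type} [NormedAddCommGroup H] [InnerProductSpace ℝ H]

/-- The weight `(1 + |Lx|²)^r`, for `L` a linear map on the plane. -/
def weight (L : Plane →L[ℝ] H) (r : ℝ) (x : Plane) : ℝ := (1 + ‖L x‖ ^ 2) ^ r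

theorem weight_pos (L : Plane →L[ℝ] H) (r : ℝ) (x : Plane) : 0 < weight L r x :=
  Real.rpow_pos_of_pos (by positivity) r

theorem weight_le_one (L : Plane →L[ℝ] H) {r : ℝ} (hr : r ≤ 0) (x : Plane) : weight L r x ≤ 1 :=
  Real.rpow_le_one_of_one_le_of_nonpos (by nlinarith [sq_nonneg ‖L x‖]) hr

theorem abs_weight_le_one (L : Plane →L[ℝ] H) {r : ℝ} (hr : r ≤ 0) (x : Plane) :
    |weight L r x| ≤ 1 := by
  rw [abs_of_pos (weight_pos L r x)]; exact weight_le_one L hr x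

theorem weight_add_one (L : Plane →L[ℝ] H) (r : ℝ) (x : Plane) :
    weight L (r + 1) x = (1 + ‖L x‖ ^ 2) * weight L r x := by
  rw [weight, weight, Real.rpow_add (by positivity), Real.rpow_one, mul_comm]

theorem norm_mul_weight_le (L : Plane →L[ℝ] H) (r : ℝ) (hr : r ≤ -1 / 2) (x : Plane) :
    ‖L x‖ * weight L r x ≤ 1 := by
  have h1 : ‖L x‖ ≤ (1 + ‖L x‖ ^ 2) ^ (1 / 2 : ℝ) := by
    rw [← Real.sqrt_eq_rpow]
    exact Real.le_sqrt_of_sq_le (by linarith)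
  calc ‖L x‖ * weight L r x ≤ (1 + ‖L x‖ ^ 2) ^ (1 / 2 : ℝ) * (1 + ‖L x‖ ^ 2) ^ r :=
        mul_le_mul_of_nonneg_right h1 (weight_pos L r x).le
    _ = (1 + ‖L x‖ ^ 2) ^ (1 / 2 + r) := (Real.rpow_add (by positivity) _ _).symm
    _ ≤ 1 := Real.rpow_le_one_of_one_le_of_nonpos (by nlinarith [sq_nonneg ‖L x‖]) (by linarith)

theorem hasTemperateGrowth_weight (L : Plane →L[ℝ] H) (r : ℝ) :
    (weight L r).HasTemperateGrowth :=
  (Function.hasTemperateGrowth_one_add_norm_sq_rpow H r).comp L.hasTemperateGrowth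

theorem hasFDerivAt_weight (L : Plane →L[ℝ] H) (r : ℝ) (x : Plane) :
    HasFDerivAt (weight L r)
      ((r * weight L (r - 1) x) • (2 • (innerSL ℝ (L x)) ∘L L)) x := by
  have h1 : HasFDerivAt (fun x => 1 + ‖L x‖ ^ 2) (2 • (innerSL ℝ (L x)) ∘L L) x := by
    have := (L.hasFDerivAt (x := x)).norm_sq
    simpa using this.const_add 1
  have := h1.rpow_const (p := r) (Or.inl (by positivity))
  exact this

theorem temperatePartial_weight (L : Plane →L[ℝ] H) (r : ℝ) (j : Fin 2) :
    TemperatePartial j (weight L r) (fun x => 2 * r * weight L (r - 1) x *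
      inner ℝ (L x) (L (EuclideanSpace.single j 1))) where
  growth := hasTemperateGrowth_weight L r
  growth' := ((Function.HasTemperateGrowth.const (2 * r)).mul
      (hasTemperateGrowth_weight L (r - 1))).mul
    ((Function.hasTemperateGrowth_inner_left _).comp L.hasTemperateGrowth)
  differentiable x := (hasFDerivAt_weight L r x).differentiableAt
  fderiv_eq x := by
    rw [(hasFDerivAt_weight L r x).fderiv]
    simp
    ring

theorem abs_partial_weight_le (L : Plane →L[ℝ] H) {r : ℝ} (hr : r ≤ 0) (v x : Plane) :
    |2 * r * weight L (r - 1) x * inner ℝ (L x) (L v)| ≤ 2 * |r| * ‖L v‖ := by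
  have h1 := abs_real_inner_le_norm (L x) (L v)
  have h2 := norm_mul_weight_le L (r - 1) (by linarith) x
  have h3 := (weight_pos L (r - 1) x).le
  rw [abs_mul, abs_mul, abs_mul, abs_of_pos (weight_pos L _ x), abs_two]
  calc 2 * |r| * weight L (r - 1) x * |inner ℝ (L x) (L v)|
      ≤ 2 * |r| * weight L (r - 1) x * (‖L x‖ * ‖L v‖) := by gcongr
    _ = 2 * |r| * ‖L v‖ * (‖L x‖ * weight L (r - 1) x) := by ring
    _ ≤ 2 * |r| * ‖L v‖ * 1 := by gcongr
    _ = _ := mul_one _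

end Weights

/-- The rescaled coordinate `x_j / R`. -/
def scaledCoord (R : ℝ) (j : Fin 2) : Plane →L[ℝ] ℝ := R⁻¹ • EuclideanSpace.proj j

/-- The dilation `x / R`. -/
def dilation (R : ℝ) : Plane →L[ℝ] Plane := R⁻¹ • ContinuousLinearMap.id ℝ Plane

theorem scaledCoord_single (R : ℝ) (j k : Fin 2) :
    scaledCoord R j (EuclideanSpace.single k 1) = if j = k then R⁻¹ else 0 := by
  simp [scaledCoord]

/-- The bounded multiplier `x_j (1 + x_j² / R²)^{-1/2}` of the virial argument. -/
def multiplier (R : ℝ) (j : Fin 2) (x : Plane) : ℝ :=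
  R * (scaledCoord R j x * weight (scaledCoord R j) (-1 / 2) x)

theorem abs_multiplier_le {R : ℝ} (hR : 0 < R) (j : Fin 2) (x : Plane) :
    |multiplier R j x| ≤ R := by
  have := norm_mul_weight_le (scaledCoord R j) (-1 / 2) le_rfl x
  rw [multiplier, abs_mul, abs_mul, abs_of_pos hR, abs_of_pos (weight_pos _ _ x)]
  exact mul_le_of_le_one_right hR.le this

theorem hasTemperateGrowth_multiplier (R : ℝ) (j : Fin 2) :
    (multiplier R j).HasTemperateGrowth :=
  (Function.HasTemperateGrowth.const R).mul
    ((scaledCoord R j).hasTemperateGrowth.mul (hasTemperateGrowth_weight _ _))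

theorem hasFDerivAt_multiplier {R : ℝ} (j : Fin 2) (x : Plane) :
    HasFDerivAt (multiplier R j)
      ((R * weight (scaledCoord R j) (-3 / 2) x) • scaledCoord R j) x := by
  have h := (((scaledCoord R j).hasFDerivAt (x := x)).mul
    (hasFDerivAt_weight (scaledCoord R j) (-1 / 2) x)).const_mul R
  refine h.congr_fderiv ?_
  ext v
  have e : (-1 / 2 : ℝ) = -3 / 2 + 1 := by norm_num
  have e' : (-1 / 2 - 1 : ℝ) = -3 / 2 := by norm_num
  have e2 := weight_add_one (scaledCoord R j) (-3 / 2) x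
  rw [← e] at e2
  rw [e', e2]
  simp
  ring

theorem temperatePartial_multiplier {R : ℝ} (hR : 0 < R) (j : Fin 2) :
    TemperatePartial j (multiplier R j) (weight (scaledCoord R j) (-3 / 2)) where
  growth := hasTemperateGrowth_multiplier R j
  growth' := hasTemperateGrowth_weight _ _
  differentiable x := (hasFDerivAt_multiplier j x).differentiableAt
  fderiv_eq x := by
    rw [(hasFDerivAt_multiplier j x).fderiv]
    simp only [smul_apply, scaledCoord_single, smul_eq_mul, if_true]
    field_simp

theorem temperatePartial_multiplier_of_ne {R : ℝ} {j k : Fin 2} (hjk : j ≠ k) :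
    TemperatePartial k (multiplier R j) (fun _ => 0) where
  growth := hasTemperateGrowth_multiplier R j
  growth' := Function.HasTemperateGrowth.const 0
  differentiable x := (hasFDerivAt_multiplier j x).differentiableAt
  fderiv_eq x := by
    rw [(hasFDerivAt_multiplier j x).fderiv]
    simp [scaledCoord_single, hjk]

theorem weight_dilation_le (R : ℝ) (j : Fin 2) (x : Plane) :
    weight (dilation R) (-3 / 2) x ≤ weight (scaledCoord R j) (-3 / 2) x := by
  refine Real.rpow_le_rpow_of_nonpos (by positivity) ?_ (by norm_num)
  have h : ‖scaledCoord R j x‖ ≤ ‖dilation R x‖ := by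
    have := PiLp.norm_apply_le (dilation R x) j
    simpa [dilation, scaledCoord] using this
  gcongr

section LocalEstimate

variable {B R t n p E : ℝ} {φ : 𝓢(Plane, ℂ)}

/-- The kinetic energy of the `j`-th component in the strip `|x_j| ≲ R`: summing the virial
identity with multiplier `f(x_j)` and the localized energy identity with weight `f'(x_j)`
isolates `∫ f'(x_j) |π_j φ|²`. -/
theorem two_mul_strip_energy_le (hB : 0 < B) (hR : 0 < R) (hE : 0 ≤ E) (hp : 0 ≤ p) (j : Fin 2)
    (hφ : ‖schwartzToL2 φ‖ ≤ n)
    (hm : ∀ k, ‖schwartzToL2 (momentum B k φ)‖ ≤ p)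
    (hEφ : ‖schwartzToL2 (landauSchwartz B φ - (t : ℂ) • φ)‖ ≤ E) :
    2 * (ip (momentum B j φ)
      (smulR (weight (scaledCoord R j) (-3 / 2)) (momentum B j φ))).re ≤
      2 * R * (E * p) + 2 * B * R * (p * n) + E * n + 3 / R * (p * n) := by
  have hn : 0 ≤ n := (norm_nonneg _).trans hφ
  obtain ⟨k, hjk⟩ : ∃ k, j ≠ k := by
    fin_cases j
    · exact ⟨1, by decide⟩
    · exact ⟨0, by decide⟩
  obtain ⟨β, hβ, hc⟩ := exists_momentum_commutator B hjk
  have hv := virial_identity B hjk (temperatePartial_multiplier hR j)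
    (temperatePartial_multiplier_of_ne hjk) t hc φ
  have he := energy_identity B (temperatePartial_weight (scaledCoord R j) (-3 / 2) 0)
    (temperatePartial_weight (scaledCoord R j) (-3 / 2) 1) t φ
  have b1 := (Complex.abs_im_le_norm _).trans (abs_ip_smulR_le (hasTemperateGrowth_multiplier R j)
    (abs_multiplier_le hR j) (landauSchwartz B φ - (t : ℂ) • φ) (momentum B j φ))
  have b2 := (Complex.abs_re_le_norm _).trans (abs_ip_smulR_le (hasTemperateGrowth_multiplier R j)
    (abs_multiplier_le hR j) (momentum B k φ) φ)
  have b3 := (Complex.abs_re_le_norm _).trans (abs_ip_smulR_le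
    (hasTemperateGrowth_weight (scaledCoord R j) (-3 / 2))
    (abs_weight_le_one (scaledCoord R j) (by norm_num)) (landauSchwartz B φ - (t : ℂ) • φ) φ)
  have b4 : ∀ i, |(ip (momentum B i φ) (smulR (fun x => 2 * (-3 / 2) *
      weight (scaledCoord R j) (-3 / 2 - 1) x * inner ℝ (scaledCoord R j x)
        (scaledCoord R j (EuclideanSpace.single i 1))) φ)).im| ≤
      (if j = i then 3 / R else 0) * (p * n) := fun i => by
    refine (Complex.abs_im_le_norm _).trans ((abs_ip_smulR_le
      (temperatePartial_weight (scaledCoord R j) (-3 / 2) i).growth'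
      (abs_partial_weight_le (scaledCoord R j) (by norm_num) _) _ _).trans ?_)
    have e : 2 * |(-3 / 2 : ℝ)| * ‖scaledCoord R j (EuclideanSpace.single i 1)‖ =
        if j = i then 3 / R else 0 := by
      rw [scaledCoord_single]
      split_ifs
      · rw [Real.norm_of_nonneg (by positivity), abs_of_neg (by norm_num)]; ring
      · simp
    rw [e]
    gcongr
    exact hm i
  have b40 := b4 0
  have b41 := b4 1
  have c1 : R * (‖schwartzToL2 (landauSchwartz B φ - (t : ℂ) • φ)‖ *
      ‖schwartzToL2 (momentum B j φ)‖) ≤ R * (E * p) := by gcongr; exact hm j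
  have c2 : |β| * |(ip (momentum B k φ) (smulR (multiplier R j) φ)).re| ≤ B * (R * (p * n)) := by
    rw [hβ, abs_of_pos hB]
    gcongr
    refine b2.trans ?_
    gcongr
    exact hm k
  have c3 : 1 * (‖schwartzToL2 (landauSchwartz B φ - (t : ℂ) • φ)‖ * ‖schwartzToL2 φ‖) ≤ E * n := by
    rw [one_mul]; gcongr
  rw [← abs_mul] at c2
  have d1 := neg_le_of_abs_le (b1.trans c1)
  have d2 := neg_le_of_abs_le c2
  have d3 := le_of_abs_le (b3.trans c3)
  have d4 := neg_le_of_abs_le b40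
  have d5 := neg_le_of_abs_le b41
  have h01 : (j = 0 ∧ k = 1) ∨ (j = 1 ∧ k = 0) := by
    fin_cases j <;> fin_cases k <;> simp_all
  rcases h01 with ⟨rfl, rfl⟩ | ⟨rfl, rfl⟩
  · simp only [if_true, Fin.isValue, zero_ne_one, if_false] at d4 d5
    linarith
  · simp only [if_true, Fin.isValue, one_ne_zero, if_false] at d4 d5
    linarith

/-- The local estimate for approximate eigenfunctions: the mass of `φ` in the disc of radius `R`
is at most of the order of `R t^{-1/2}`, if `φ` is close to being an eigenfunction of eigenvalue
`t`. -/
theorem disc_mass_le (hB : 0 < B) (hR : 0 < R) (hE : 0 ≤ E) (hp : 0 ≤ p)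
    (hφ : ‖schwartzToL2 φ‖ ≤ n)
    (hm : ∀ k, ‖schwartzToL2 (momentum B k φ)‖ ≤ p)
    (hEφ : ‖schwartzToL2 (landauSchwartz B φ - (t : ℂ) • φ)‖ ≤ E) :
    t * (ip φ (smulR (weight (dilation R) (-3 / 2)) φ)).re ≤
      2 * R * (E * p) + 2 * (E * n) + (2 * B * R + 9 / R) * (p * n) := by
  have hn : 0 ≤ n := (norm_nonneg _).trans hφ
  have hs := fun j => two_mul_strip_energy_le hB hR hE hp j hφ hm hEφ
  have hmono := fun j => re_ip_smulR_mono (hasTemperateGrowth_weight (dilation R) (-3 / 2))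
    (hasTemperateGrowth_weight (scaledCoord R j) (-3 / 2)) (weight_dilation_le R j)
    (momentum B j φ)
  have he := energy_identity B (temperatePartial_weight (dilation R) (-3 / 2) 0)
    (temperatePartial_weight (dilation R) (-3 / 2) 1) t φ
  have b3 := (Complex.abs_re_le_norm _).trans (abs_ip_smulR_le
    (hasTemperateGrowth_weight (dilation R) (-3 / 2))
    (abs_weight_le_one (dilation R) (by norm_num)) (landauSchwartz B φ - (t : ℂ) • φ) φ)
  have b4 : ∀ i, |(ip (momentum B i φ) (smulR (fun x => 2 * (-3 / 2) *
      weight (dilation R) (-3 / 2 - 1) x * inner ℝ (dilation R x)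
        (dilation R (EuclideanSpace.single i 1))) φ)).im| ≤ 3 / R * (p * n) := fun i => by
    refine (Complex.abs_im_le_norm _).trans ((abs_ip_smulR_le
      (temperatePartial_weight (dilation R) (-3 / 2) i).growth'
      (abs_partial_weight_le (dilation R) (by norm_num) _) _ _).trans ?_)
    have e : 2 * |(-3 / 2 : ℝ)| * ‖dilation R (EuclideanSpace.single i 1)‖ = 3 / R := by
      have : dilation R (EuclideanSpace.single i 1) = R⁻¹ • EuclideanSpace.single i 1 := rfl
      rw [this, norm_smul, Real.norm_of_nonneg (by positivity), abs_of_neg (by norm_num)]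
      simp
      ring
    rw [e]
    gcongr
    exact hm i
  have c3 : 1 * (‖schwartzToL2 (landauSchwartz B φ - (t : ℂ) • φ)‖ * ‖schwartzToL2 φ‖) ≤ E * n := by
    rw [one_mul]; gcongr
  have d3 := neg_le_of_abs_le (b3.trans c3)
  have d4 := le_of_abs_le (b4 0)
  have d5 := le_of_abs_le (b4 1)
  have e9 : 9 / R * (p * n) = 3 * (3 / R * (p * n)) := by ring
  have := hs 0
  have := hs 1
  have := hmono 0
  have := hmono 1
  rw [add_mul, e9]
  linarith

end LocalEstimate

/-! ### The Gaussian ground state and its polynomial multiples -/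

/-- Every power of `1 + s` is dominated by `e^{b s²}`. -/
theorem exists_one_add_pow_mul_exp_le {b : ℝ} (hb : 0 < b) (k : ℕ) :
    ∃ C, ∀ s : ℝ, 0 ≤ s → (1 + s) ^ k * Real.exp (-b * s ^ 2) ≤ C := by
  have hb' : 0 < 1 + 1 / b := by positivity
  refine ⟨k.factorial * Real.exp (1 + 1 / b), fun s hs => ?_⟩
  have h1 : (1 + s) ^ k ≤ k.factorial * Real.exp (1 + s) := by
    have := Real.pow_div_factorial_le_exp (x := 1 + s) (by linarith) k
    rw [div_le_iff₀ (by positivity)] at this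
    linarith
  calc (1 + s) ^ k * Real.exp (-b * s ^ 2)
      ≤ (k.factorial * Real.exp (1 + s)) * Real.exp (-b * s ^ 2) := by gcongr
    _ = k.factorial * Real.exp (1 + s + -b * s ^ 2) := by rw [mul_assoc, ← Real.exp_add]
    _ ≤ _ := by
      refine mul_le_mul_of_nonneg_left (Real.exp_le_exp.2 ?_) (by positivity)
      have : s ≤ 1 / b + b * s ^ 2 := by
        have h2 : 0 ≤ (b * s - 1) ^ 2 / b + s := by positivity
        have h3 : (b * s - 1) ^ 2 / b + s = 1 / b + b * s ^ 2 - s := by field_simp; ring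
        linarith
      linarith

/-- The Gaussian `e^{-b|x|²}` as a Schwartz function. -/
def gaussianS (b : ℝ) (hb : 0 < b) : 𝓢(Plane, ℂ) where
  toFun x := ((Real.exp (-b * ‖x‖ ^ 2) : ℝ) : ℂ)
  smooth' := by
    have : ContDiff ℝ (⊤ : ℕ∞) fun x : Plane => Real.exp (-b * ‖x‖ ^ 2) :=
      (contDiff_const.mul (contDiff_norm_sq ℝ)).exp
    exact Complex.ofRealCLM.contDiff.comp this
  decay' := by
    intro k n
    have hf : Function.HasTemperateGrowth fun x : Plane => -b * ‖x‖ ^ 2 :=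
      (Function.HasTemperateGrowth.const (-b)).mul (Function.hasTemperateGrowth_norm_sq Plane)
    obtain ⟨m, C, hC, hm⟩ := hf.norm_iteratedFDeriv_le_uniform n
    obtain ⟨K, hK⟩ := exists_one_add_pow_mul_exp_le hb (k + m * n)
    refine ⟨n.factorial * (1 + C) ^ n * K, fun x => ?_⟩
    have h0 : ‖iteratedFDeriv ℝ n (fun x : Plane => ((Real.exp (-b * ‖x‖ ^ 2) : ℝ) : ℂ)) x‖ =
        ‖iteratedFDeriv ℝ n (fun x : Plane => Real.exp (-b * ‖x‖ ^ 2)) x‖ := by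
      have hs : ContDiff ℝ n fun x : Plane => Real.exp (-b * ‖x‖ ^ 2) :=
        (contDiff_const.mul (contDiff_norm_sq ℝ)).exp
      exact Complex.ofRealLI.norm_iteratedFDeriv_comp_left hs.contDiffAt le_rfl
    have h1 : ‖iteratedFDeriv ℝ n (fun x : Plane => Real.exp (-b * ‖x‖ ^ 2)) x‖ ≤
        n.factorial * Real.exp (-b * ‖x‖ ^ 2) * ((1 + C) * (1 + ‖x‖) ^ m) ^ n := by
      refine norm_iteratedFDeriv_comp_le (N := n) (g := Real.exp) Real.contDiff_exp
        (hf.1.of_le (by exact_mod_cast le_top)) le_rfl x ?_ ?_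
      · intro i _
        rw [norm_iteratedFDeriv_eq_norm_iteratedDeriv, iteratedDeriv_eq_iterate,
          Real.iter_deriv_exp, Real.norm_of_nonneg (Real.exp_pos _).le]
      · intro i hi hin
        have h2 : 1 ≤ (1 + C) * (1 + ‖x‖) ^ m :=
          one_le_mul_of_one_le_of_one_le (by linarith)
            (one_le_pow₀ (by linarith [norm_nonneg x]))
        calc _ ≤ C * (1 + ‖x‖) ^ m := hm i hin x
          _ ≤ (1 + C) * (1 + ‖x‖) ^ m := by gcongr; linarith
          _ ≤ _ := le_self_pow₀ h2 (by omega)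
    rw [h0]
    have h3 : ‖x‖ ^ k ≤ (1 + ‖x‖) ^ k := by gcongr; linarith
    calc _ ≤ (1 + ‖x‖) ^ k *
          (n.factorial * Real.exp (-b * ‖x‖ ^ 2) * ((1 + C) * (1 + ‖x‖) ^ m) ^ n) := by gcongr
      _ = n.factorial * (1 + C) ^ n *
          ((1 + ‖x‖) ^ (k + m * n) * Real.exp (-b * ‖x‖ ^ 2)) := by
        rw [mul_pow, ← pow_mul, pow_add]; ring
      _ ≤ _ := by gcongr; exact hK _ (norm_nonneg x)

theorem gaussianS_apply (b : ℝ) (hb : 0 < b) (x : Plane) :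
    gaussianS b hb x = (Real.exp (-b * ‖x‖ ^ 2) : ℝ) := rfl

/-- The complex coordinate `z = x₁ + i x₂`. -/
def zCoord : Plane →L[ℝ] ℂ :=
  Complex.ofRealCLM ∘L EuclideanSpace.proj 0 +
    Complex.I • (Complex.ofRealCLM ∘L EuclideanSpace.proj 1)

/-- The conjugate coordinate `z̄ = x₁ - i x₂`. -/
def zbarCoord : Plane →L[ℝ] ℂ :=
  Complex.ofRealCLM ∘L EuclideanSpace.proj 0 -
    Complex.I • (Complex.ofRealCLM ∘L EuclideanSpace.proj 1)

theorem zCoord_apply (x : Plane) : zCoord x = x 0 + Complex.I * x 1 := by simp [zCoord]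

theorem zbarCoord_apply (x : Plane) : zbarCoord x = x 0 - Complex.I * x 1 := by simp [zbarCoord]

theorem momentum_linear (B : ℝ) (j : Fin 2) (L : Plane →L[ℝ] ℂ) (φ : 𝓢(Plane, ℂ)) :
    momentum B j (smulS L φ) =
      smulS L (momentum B j φ) - (Complex.I * L (EuclideanSpace.single j 1)) • φ := by
  rw [momentum_smulS B j L.hasTemperateGrowth (Function.HasTemperateGrowth.const _)
    (hasPartial_linear j L), smulS_const, smul_smul]

/-- The annihilation operator `π₁ + iπ₂`. -/
def lowering (B : ℝ) : 𝓢(Plane, ℂ) →ₗ[ℂ] 𝓢(Plane, ℂ) := momentum B 0 + Complex.I • momentum B 1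

/-- The creation operator `π₁ - iπ₂`. -/
def raising (B : ℝ) : 𝓢(Plane, ℂ) →ₗ[ℂ] 𝓢(Plane, ℂ) := momentum B 0 - Complex.I • momentum B 1

theorem landauSchwartz_eq_raising_lowering (B : ℝ) (φ : 𝓢(Plane, ℂ)) :
    landauSchwartz B φ = raising B (lowering B φ) + (B : ℂ) • φ := by
  have h := momentum_commutator B φ
  have h1 : (B : ℂ) • φ = (-Complex.I) •
      (momentum B 0 (momentum B 1 φ) - momentum B 1 (momentum B 0 φ)) := by
    rw [h, smul_smul, ← mul_assoc]; simp
  rw [h1, landauSchwartz_eq B zero_ne_one]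
  simp only [raising, lowering, LinearMap.add_apply, LinearMap.sub_apply, LinearMap.smul_apply,
    map_add, map_smul]
  match_scalars <;> ring_nf
  simp

theorem lowering_z (B : ℝ) (φ : 𝓢(Plane, ℂ)) :
    lowering B (smulS zCoord φ) = smulS zCoord (lowering B φ) := by
  simp only [lowering, LinearMap.add_apply, LinearMap.smul_apply, momentum_linear, zCoord_apply,
    map_add, map_smul]
  simp

theorem lowering_zbar (B : ℝ) (φ : 𝓢(Plane, ℂ)) :
    lowering B (smulS zbarCoord φ) =
      smulS zbarCoord (lowering B φ) - (2 * Complex.I) • φ := by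
  simp only [lowering, LinearMap.add_apply, LinearMap.smul_apply, momentum_linear, zbarCoord_apply,
    map_add, map_smul]
  simp [smul_sub]
  module

theorem raising_z (B : ℝ) (φ : 𝓢(Plane, ℂ)) :
    raising B (smulS zCoord φ) = smulS zCoord (raising B φ) - (2 * Complex.I) • φ := by
  simp only [raising, LinearMap.sub_apply, LinearMap.smul_apply, momentum_linear, zCoord_apply,
    map_sub, map_smul]
  simp
  module

theorem raising_zbar (B : ℝ) (φ : 𝓢(Plane, ℂ)) :
    raising B (smulS zbarCoord φ) = smulS zbarCoord (raising B φ) := by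
  simp only [raising, LinearMap.sub_apply, LinearMap.smul_apply, momentum_linear, zbarCoord_apply,
    map_sub, map_smul]
  simp [smul_sub]

/-- The ground state `e^{-B|x|²/4}`. -/
def ground (B : ℝ) (hB : 0 < B) : 𝓢(Plane, ℂ) := gaussianS (B / 4) (by positivity)

theorem momentum_ground (B : ℝ) (hB : 0 < B) (j : Fin 2) (x : Plane) :
    momentum B j (ground B hB) x =
      (Complex.I * (B / 2) * x j - vectorPotential B x j) * ground B hB x := by
  have h : HasFDerivAt (fun x : Plane => Real.exp (-(B / 4) * ‖x‖ ^ 2))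
      (Real.exp (-(B / 4) * ‖x‖ ^ 2) • (-(B / 4)) • (2 • innerSL ℝ x)) x := by
    have := (hasStrictFDerivAt_norm_sq x).hasFDerivAt
    exact (this.const_mul (-(B / 4))).exp
  have h2 : HasFDerivAt (ground B hB : Plane → ℂ) (Complex.ofRealCLM ∘L
      (Real.exp (-(B / 4) * ‖x‖ ^ 2) • (-(B / 4)) • (2 • innerSL ℝ x))) x :=
    Complex.ofRealCLM.hasFDerivAt.comp x h
  have h3 : partialS j (ground B hB) x = -(B / 2) * x j * ground B hB x := by
    rw [partialS_apply, h2.fderiv]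
    have : ground B hB x = (Real.exp (-(B / 4) * ‖x‖ ^ 2) : ℝ) := rfl
    rw [this]
    simp [EuclideanSpace.inner_single_right]
    ring
  rw [momentum_eq, sub_apply, smul_apply, h3, smulS_apply (vectorPotential_hasTemperateGrowth B j)]
  simp
  ring

theorem lowering_ground (B : ℝ) (hB : 0 < B) : lowering B (ground B hB) = 0 := by
  ext x
  have : lowering B (ground B hB) x =
      momentum B 0 (ground B hB) x + Complex.I * momentum B 1 (ground B hB) x := rfl
  rw [this, momentum_ground, momentum_ground]
  simp [vectorPotential]
  ring_nf
  simp

theorem raising_ground (B : ℝ) (hB : 0 < B) :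
    raising B (ground B hB) = (Complex.I * B) • smulS zbarCoord (ground B hB) := by
  ext x
  have : raising B (ground B hB) x =
      momentum B 0 (ground B hB) x - Complex.I * momentum B 1 (ground B hB) x := rfl
  rw [this, momentum_ground, momentum_ground, smul_apply, smulS_apply zbarCoord.hasTemperateGrowth,
    zbarCoord_apply]
  simp [vectorPotential]
  ring_nf
  simp
  ring

/-- The functions `z^a z̄^b e^{-B|x|²/4}`. -/
def monomialS (B : ℝ) (hB : 0 < B) (a b : ℕ) : 𝓢(Plane, ℂ) :=
  (smulS zCoord)^[a] ((smulS zbarCoord)^[b] (ground B hB))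

theorem z_monomialS (B : ℝ) (hB : 0 < B) (a b : ℕ) :
    smulS zCoord (monomialS B hB a b) = monomialS B hB (a + 1) b :=
  (Function.iterate_succ_apply' _ _ _).symm

theorem zbar_monomialS (B : ℝ) (hB : 0 < B) (a b : ℕ) :
    smulS zbarCoord (monomialS B hB a b) = monomialS B hB a (b + 1) := by
  induction a with
  | zero => exact (Function.iterate_succ_apply' (smulS zbarCoord) b (ground B hB)).symm
  | succ a ih =>
    rw [← z_monomialS, ← z_monomialS, ← ih,
      smulS_comm zbarCoord.hasTemperateGrowth zCoord.hasTemperateGrowth]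

theorem lowering_monomialS_zero (B : ℝ) (hB : 0 < B) (a : ℕ) :
    lowering B (monomialS B hB a 0) = 0 := by
  induction a with
  | zero => exact lowering_ground B hB
  | succ a ih => rw [← z_monomialS, lowering_z, ih, map_zero]

theorem lowering_monomialS_succ (B : ℝ) (hB : 0 < B) (a b : ℕ) :
    lowering B (monomialS B hB a (b + 1)) = (-2 * Complex.I * (b + 1)) • monomialS B hB a b := by
  induction b with
  | zero =>
    rw [← zbar_monomialS, lowering_zbar, lowering_monomialS_zero, map_zero]
    simp
  | succ b ih =>
    rw [← zbar_monomialS, lowering_zbar, ih, map_smul, zbar_monomialS]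
    push_cast
    module

theorem raising_monomialS_zero (B : ℝ) (hB : 0 < B) (b : ℕ) :
    raising B (monomialS B hB 0 b) = (Complex.I * B) • monomialS B hB 0 (b + 1) := by
  induction b with
  | zero => exact raising_ground B hB
  | succ b ih => rw [← zbar_monomialS, raising_zbar, ih, map_smul, zbar_monomialS]

theorem raising_monomialS_succ (B : ℝ) (hB : 0 < B) (a b : ℕ) :
    raising B (monomialS B hB (a + 1) b) = (Complex.I * B) • monomialS B hB (a + 1) (b + 1)
      - (2 * Complex.I * (a + 1)) • monomialS B hB a b := by
  induction a with
  | zero =>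
    rw [← z_monomialS, raising_z, raising_monomialS_zero, map_smul, z_monomialS]
    simp
  | succ a ih =>
    rw [← z_monomialS, raising_z, ih, map_sub, map_smul, map_smul, z_monomialS, z_monomialS]
    push_cast
    module

/-- The Landau Hamiltonian maps the Schwartz space onto a space containing every function
`z^a z̄^b e^{-B|x|²/4}`: it is triangular on these, with non-zero diagonal entries `B (2b + 1)`. -/
theorem monomialS_mem_range (B : ℝ) (hB : 0 < B) (a b : ℕ) :
    monomialS B hB a b ∈ LinearMap.range (landauSchwartz B) := by
  have hB' : (B : ℂ) ≠ 0 := by exact_mod_cast hB.ne'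
  induction b generalizing a with
  | zero =>
    refine ⟨(B : ℂ)⁻¹ • monomialS B hB a 0, ?_⟩
    rw [map_smul, landauSchwartz_eq_raising_lowering, lowering_monomialS_zero, map_zero, zero_add,
      smul_smul, inv_mul_cancel₀ hB', one_smul]
  | succ b ih =>
    have hd : (B : ℂ) * (2 * b + 3) ≠ 0 := by
      refine mul_ne_zero hB' ?_
      exact_mod_cast (by omega : 2 * b + 3 ≠ 0)
    have hrest : landauSchwartz B (monomialS B hB a (b + 1)) -
        ((B : ℂ) * (2 * b + 3)) • monomialS B hB a (b + 1) ∈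
          LinearMap.range (landauSchwartz B) := by
      rw [landauSchwartz_eq_raising_lowering, lowering_monomialS_succ, map_smul]
      cases a with
      | zero =>
        rw [raising_monomialS_zero, smul_smul]
        refine (congrArg (· ∈ LinearMap.range (landauSchwartz B)) ?_).mpr (zero_mem _)
        rw [← add_smul, ← sub_smul]
        convert! zero_smul ℂ _ using 2
        linear_combination (-2 * (b + 1) * B : ℂ) * Complex.I_mul_I
      | succ a =>
        rw [raising_monomialS_succ, smul_sub, smul_smul, smul_smul]
        convert Submodule.smul_mem _ (-(4 * (a + 1) * (b + 1)) : ℂ) (ih a) using 1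
        match_scalars
        · linear_combination (-2 * (b + 1) * B : ℂ) * Complex.I_mul_I
        · linear_combination (4 * (a + 1) * (b + 1) : ℂ) * Complex.I_mul_I
    have hm := Submodule.sub_mem _ (LinearMap.mem_range_self (landauSchwartz B) 
      (monomialS B hB a (b + 1))) hrest
    rw [sub_sub_cancel] at hm
    have := Submodule.smul_mem _ ((B : ℂ) * (2 * b + 3))⁻¹ hm
    rwa [smul_smul, inv_mul_cancel₀ hd, one_smul] at this

/-! ### Completeness of the polynomial multiples of the Gaussian -/

/-- The linear form `x ↦ x·ξ`, with complex values. -/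
def linearForm (ξ : Plane) : Plane →L[ℝ] ℂ := Complex.ofRealCLM ∘L innerSL ℝ ξ

theorem linearForm_apply (ξ x : Plane) : linearForm ξ x = (inner ℝ ξ x : ℝ) := rfl

theorem linearForm_eq (ξ x : Plane) : linearForm ξ x =
    ((ξ 0 - Complex.I * ξ 1) / 2) * zCoord x + ((ξ 0 + Complex.I * ξ 1) / 2) * zbarCoord x := by
  rw [linearForm_apply, zCoord_apply, zbarCoord_apply, PiLp.inner_apply, Fin.sum_univ_two]
  simp
  linear_combination (ξ 1 * x 1 : ℂ) * Complex.I_mul_I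

theorem linearForm_iterate_mem_span (B : ℝ) (hB : 0 < B) (ξ : Plane) (n : ℕ) :
    (smulS (linearForm ξ))^[n] (ground B hB) ∈
      Submodule.span ℂ (Set.range fun p : ℕ × ℕ => monomialS B hB p.1 p.2) := by
  set T := Submodule.span ℂ (Set.range fun p : ℕ × ℕ => monomialS B hB p.1 p.2)
  have hmem : ∀ a b, monomialS B hB a b ∈ T := fun a b => Submodule.subset_span ⟨(a, b), rfl⟩
  induction n with
  | zero => exact hmem 0 0
  | succ n ih =>
    rw [Function.iterate_succ_apply']
    refine Submodule.span_induction (p := fun φ _ => smulS (linearForm ξ) φ ∈ T)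
      ?_ ?_ ?_ ?_ ih
    · rintro _ ⟨⟨a, b⟩, rfl⟩
      have : smulS (linearForm ξ) (monomialS B hB a b) =
          ((ξ 0 - Complex.I * ξ 1) / 2 : ℂ) • monomialS B hB (a + 1) b +
          ((ξ 0 + Complex.I * ξ 1) / 2 : ℂ) • monomialS B hB a (b + 1) := by
        rw [← z_monomialS, ← zbar_monomialS]
        ext x
        rw [smulS_apply (linearForm ξ).hasTemperateGrowth, add_apply, smul_apply, smul_apply,
          smulS_apply zCoord.hasTemperateGrowth, smulS_apply zbarCoord.hasTemperateGrowth,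
          linearForm_eq]
        simp only [smul_eq_mul]
        ring
      rw [this]
      exact add_mem (T.smul_mem _ (hmem _ _)) (T.smul_mem _ (hmem _ _))
    · rw [map_zero]; exact zero_mem T
    · intro φ ψ _ _ hφ hψ
      rw [map_add]; exact add_mem hφ hψ
    · intro c φ _ hφ
      rw [map_smul]; exact T.smul_mem c hφ

theorem linearForm_iterate_apply (B : ℝ) (hB : 0 < B) (ξ : Plane) (n : ℕ) (x : Plane) :
    (smulS (linearForm ξ))^[n] (ground B hB) x = linearForm ξ x ^ n * ground B hB x := by
  induction n with
  | zero => simp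
  | succ n ih =>
    rw [Function.iterate_succ_apply', smulS_apply (linearForm ξ).hasTemperateGrowth, ih]
    ring

/-- The Gaussian beats every exponential when paired with a square integrable function. -/
theorem integrable_exp_mul_gaussian_mul {b : ℝ} (hb : 0 < b) (κ : ℝ) (u : L2) :
    Integrable fun x : Plane => Real.exp (κ * ‖x‖) * ‖gaussianS b hb x * u x‖ := by
  have h1 : Integrable fun x : Plane => gaussianS (b / 2) (by positivity) x * u x := by
    refine (L2.integrable_inner (𝕜 := ℂ)
      (schwartzToL2 (gaussianS (b / 2) (by positivity))) u).congr ?_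
    filter_upwards [coeFn_schwartzToL2 (gaussianS (b / 2) (by positivity))] with x hx
    rw [hx, gaussianS_apply, RCLike.inner_apply, Complex.conj_ofReal, mul_comm]
  refine ((h1.norm.const_mul (Real.exp (κ ^ 2 / (2 * b))))).mono' ?_ ?_
  · exact (Real.continuous_exp.comp (continuous_const.mul continuous_norm)).aestronglyMeasurable.mul
      ((gaussianS b hb).continuous.aestronglyMeasurable.mul
        (Lp.aestronglyMeasurable u)).norm
  · refine Filter.Eventually.of_forall fun x => ?_
    rw [Real.norm_of_nonneg (by positivity), norm_mul, norm_mul, gaussianS_apply, gaussianS_apply,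
      Complex.norm_real, Complex.norm_real, Real.norm_of_nonneg (Real.exp_pos _).le,
      Real.norm_of_nonneg (Real.exp_pos _).le, ← mul_assoc, ← mul_assoc, ← Real.exp_add,
      ← Real.exp_add]
    refine mul_le_mul_of_nonneg_right (Real.exp_le_exp.2 ?_) (norm_nonneg _)
    have h2 : 0 ≤ (κ - b * ‖x‖) ^ 2 / (2 * b) := by positivity
    have h3 : (κ - b * ‖x‖) ^ 2 / (2 * b) = κ ^ 2 / (2 * b) - κ * ‖x‖ + b / 2 * ‖x‖ ^ 2 := by
      field_simp
      ring
    linarith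

/-- A square integrable function orthogonal to all `z^a z̄^b e^{-B|x|²/4}` vanishes: expanding the
exponential shows that the Fourier transform of its product with the Gaussian is zero. -/
theorem eq_zero_of_orthogonal_monomialS (B : ℝ) (hB : 0 < B) (u : L2)
    (hu : ∀ a b, inner ℂ (schwartzToL2 (monomialS B hB a b)) u = 0) : u = 0 := by
  set G : Plane → ℂ := ⇑(ground B hB)
  have hGreal : ∀ x, (starRingEnd ℂ) (G x) = G x := fun x => Complex.conj_ofReal _
  have hmom : ∀ (ξ : Plane) (n : ℕ), ∫ x, linearForm ξ x ^ n * (G x * u x) = 0 := by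
    intro ξ n
    have h0 : inner ℂ (schwartzToL2 ((smulS (linearForm ξ))^[n] (ground B hB))) u = 0 := by
      refine Submodule.span_induction (p := fun φ _ => inner ℂ (schwartzToL2 φ) u = 0)
        ?_ ?_ ?_ ?_ (linearForm_iterate_mem_span B hB ξ n)
      · rintro _ ⟨⟨a, b⟩, rfl⟩
        exact hu a b
      · simp
      · intro φ ψ _ _ hφ hψ
        rw [map_add, inner_add_left, hφ, hψ, add_zero]
      · intro c φ _ hφ
        rw [map_smul, inner_smul_left, hφ, mul_zero]
    rw [L2.inner_def] at h0
    rw [← h0]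
    refine integral_congr_ae ?_
    filter_upwards [coeFn_schwartzToL2 ((smulS (linearForm ξ))^[n] (ground B hB))] with x hx
    rw [hx, linearForm_iterate_apply, RCLike.inner_apply, map_mul, map_pow, hGreal,
      linearForm_apply, Complex.conj_ofReal]
    ring
  have hmeas : AEStronglyMeasurable (fun x => G x * u x) volume :=
    (ground B hB).continuous.aestronglyMeasurable.mul (Lp.aestronglyMeasurable u)
  have hint : ∀ κ : ℝ, Integrable fun x : Plane => Real.exp (κ * ‖x‖) * ‖G x * u x‖ :=
    fun κ => integrable_exp_mul_gaussian_mul (by positivity) κ u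
  have hint0 : Integrable fun x => G x * u x := by
    refine (integrable_norm_iff hmeas).1 ?_
    simpa using hint 0
  have hfourier : ∀ ξ : Plane,
      ∫ x, Complex.exp (-2 * Real.pi * Complex.I * linearForm ξ x) * (G x * u x) = 0 := by
    intro ξ
    set c : ℂ := -2 * Real.pi * Complex.I with hc
    have hcn : ‖c‖ = 2 * Real.pi := by simp [hc, abs_of_pos Real.pi_pos]
    have hnorm : ∀ x, ‖c * linearForm ξ x‖ ≤ (2 * Real.pi * ‖ξ‖) * ‖x‖ := fun x => by
      rw [norm_mul, hcn, linearForm_apply, Complex.norm_real]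
      exact (mul_le_mul_of_nonneg_left (norm_inner_le_norm (𝕜 := ℝ) ξ x)
        (by positivity)).trans_eq (by ring)
    have hexp : ∀ y : ℝ, HasSum (fun n : ℕ => y ^ n / n.factorial) (Real.exp y) := fun y => by
      rw [Real.exp_eq_exp_ℝ]; exact NormedSpace.expSeries_div_hasSum_exp y
    have hs := hasSum_integral_of_dominated_convergence (μ := (volume : Measure Plane))
      (F := fun (n : ℕ) x => (c * linearForm ξ x) ^ n / n.factorial * (G x * u x))
      (f := fun x => Complex.exp (c * linearForm ξ x) * (G x * u x))
      (fun (n : ℕ) x => ((2 * Real.pi * ‖ξ‖) * ‖x‖) ^ n / n.factorial * ‖G x * u x‖) ?_ ?_ ?_ ?_ ?_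
    · have hz : ∀ n : ℕ, ∫ x, (c * linearForm ξ x) ^ n / n.factorial * (G x * u x) = 0 := by
        intro n
        have : ∀ x, (c * linearForm ξ x) ^ n / n.factorial * (G x * u x) =
            (c ^ n / n.factorial) * (linearForm ξ x ^ n * (G x * u x)) := fun x => by ring
        simp_rw [this]
        rw [integral_const_mul, hmom, mul_zero]
      simp_rw [hz] at hs
      exact hs.unique hasSum_zero
    · intro n
      refine AEStronglyMeasurable.mul ?_ hmeas
      exact ((continuous_const.mul (linearForm ξ).continuous).pow n
        |>.div_const _).aestronglyMeasurable
    · intro n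
      refine Filter.Eventually.of_forall fun x => ?_
      rw [norm_mul, norm_div, norm_pow, Complex.norm_natCast]
      gcongr
      exact hnorm x
    · exact Filter.Eventually.of_forall fun x => ((hexp _).mul_right _).summable
    · refine (hint (2 * Real.pi * ‖ξ‖)).congr (Filter.Eventually.of_forall fun x => ?_)
      exact ((hexp _).mul_right _).tsum_eq.symm
    · refine Filter.Eventually.of_forall fun x => HasSum.mul_right _ ?_
      rw [Complex.exp_eq_exp_ℂ]
      exact NormedSpace.expSeries_div_hasSum_exp _
  have hFT : FourierTransform.fourier (fun x => G x * u x) = 0 := by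
    funext ξ
    rw [Real.fourier_eq', Pi.zero_apply, ← hfourier ξ]
    congr with x
    rw [linearForm_apply, real_inner_comm, smul_eq_mul]
    push_cast
    ring_nf
  have hae : (fun x => G x * u x) =ᵐ[volume] 0 := by
    refine ae_eq_zero_of_integral_contDiff_smul_eq_zero hint0.locallyIntegrable ?_
    intro g hg hgc
    have hg1 : HasCompactSupport (Complex.ofRealCLM ∘ g) := hgc.comp_left rfl
    have hg2 : ContDiff ℝ (⊤ : ℕ∞) (Complex.ofRealCLM ∘ g) := Complex.ofRealCLM.contDiff.comp hg
    -- every test function is the Fourier transform of a Schwartz function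
    set ψ : 𝓢(Plane, ℂ) := FourierTransformInv.fourierInv (hg1.toSchwartzMap hg2) with hψ
    have hψ' : FourierTransform.fourier (ψ : Plane → ℂ) = fun x => (g x : ℂ) := by
      rw [← SchwartzMap.fourier_coe, hψ, FourierTransform.fourier_fourierInv_eq]
      rfl
    have h := VectorFourier.integral_fourierIntegral_smul_eq_flip (μ := volume) (ν := volume)
      (L := innerₗ Plane) Real.continuous_fourierChar continuous_inner ψ.integrable hint0
    have hl : VectorFourier.fourierIntegral Real.fourierChar volume (innerₗ Plane) ψ =
        fun x => (g x : ℂ) := hψ'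
    have hr : VectorFourier.fourierIntegral Real.fourierChar volume (innerₗ Plane).flip
        (fun x => G x * u x) = 0 := by
      rw [flip_innerₗ]; exact hFT
    rw [hl, hr] at h
    simpa using h
  refine (Lp.eq_zero_iff_ae_eq_zero).2 ?_
  filter_upwards [hae] with x hx
  have hGx : G x ≠ 0 := Complex.ofReal_ne_zero.2 (Real.exp_pos _).ne'
  exact (mul_eq_zero.1 hx).resolve_left hGx

/-! ### Eigenfunctions as limits of Schwartz functions -/

open Filter Topology

theorem level_pos {B : ℝ} (hB : 0 < B) (q : ℕ) : 0 < level B q := by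
  unfold level; positivity

/-- The range of the Landau Hamiltonian on Schwartz functions is dense in `L²`. -/
theorem eq_zero_of_orthogonal_range {B : ℝ} (hB : 0 < B) (u : L2)
    (hu : ∀ φ, inner ℂ (schwartzToL2 (landauSchwartz B φ)) u = 0) : u = 0 := by
  refine eq_zero_of_orthogonal_monomialS B hB u fun a b => ?_
  obtain ⟨φ, hφ⟩ := monomialS_mem_range B hB a b
  rw [← hφ]
  exact hu φ

theorem norm_schwartzToL2_le {B : ℝ} (φ : 𝓢(Plane, ℂ)) :
    B * ‖schwartzToL2 φ‖ ≤ ‖schwartzToL2 (landauSchwartz B φ)‖ := by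
  have h1 := le_re_ip_landauSchwartz (B := B) φ
  have h2 := (Complex.re_le_norm _).trans (norm_ip_le (landauSchwartz B φ) φ)
  rcases (norm_nonneg (schwartzToL2 φ)).eq_or_lt with h0 | h0
  · rw [← h0, mul_zero]; exact norm_nonneg _
  · refine le_of_mul_le_mul_right ?_ h0
    nlinarith

theorem inner_landau_of_mem_levelSpace {B : ℝ} {q : ℕ} {u : L2} (hu : u ∈ levelSpace B q)
    (φ : 𝓢(Plane, ℂ)) : inner ℂ (schwartzToL2 (landauSchwartz B φ)) u =
      level B q * inner ℂ (schwartzToL2 φ) u := by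
  obtain ⟨h, he⟩ := (mem_levelSpace_iff B q u).1 hu
  have := LinearPMap.adjoint_isFormalAdjoint (landauCore_dense B) ⟨u, h⟩
    ⟨schwartzToL2 φ, φ, rfl⟩
  rw [landauCore_apply] at this
  change inner ℂ (hamiltonian B ⟨u, h⟩) _ = inner ℂ u _ at this
  rw [he, inner_smul_left, Complex.conj_ofReal] at this
  have h2 := congrArg (starRingEnd ℂ) this
  rw [map_mul, inner_conj_symm, inner_conj_symm, Complex.conj_ofReal] at h2
  exact h2.symm

/-- Every eigenfunction is a limit, in the graph norm, of Schwartz functions. This is what is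
needed of the essential self-adjointness of `(-i∇ - A)²` on the Schwartz space. -/
theorem exists_seq_of_mem_levelSpace {B : ℝ} (hB : 0 < B) {q : ℕ} {u : L2}
    (hu : u ∈ levelSpace B q) : ∃ φ : ℕ → 𝓢(Plane, ℂ),
      Tendsto (fun m => schwartzToL2 (φ m)) atTop (𝓝 u) ∧
      Tendsto (fun m => schwartzToL2 (landauSchwartz B (φ m))) atTop
        (𝓝 ((level B q : ℂ) • u)) := by
  set K := LinearMap.range (schwartzToL2 ∘ₗ landauSchwartz B)
  have hKt : K.topologicalClosure = ⊤ := by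
    rw [Submodule.topologicalClosure_eq_top_iff, Submodule.eq_bot_iff]
    intro v hv
    exact eq_zero_of_orthogonal_range hB v fun φ =>
      (Submodule.mem_orthogonal K v).1 hv _ ⟨φ, rfl⟩
  have hmem : (level B q : ℂ) • u ∈ closure (K : Set L2) := by
    rw [← Submodule.topologicalClosure_coe, hKt]; trivial
  obtain ⟨y, hyK, hy⟩ := mem_closure_iff_seq_limit.1 hmem
  choose φ hφ using hyK
  have hH : Tendsto (fun m => schwartzToL2 (landauSchwartz B (φ m))) atTop
      (𝓝 ((level B q : ℂ) • u)) := by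
    refine hy.congr fun m => (hφ m).symm
  have hc : CauchySeq fun m => schwartzToL2 (φ m) := by
    rw [Metric.cauchySeq_iff]
    intro ε hε
    obtain ⟨N, hN⟩ := Metric.cauchySeq_iff.1 hH.cauchySeq (B * ε) (by positivity)
    refine ⟨N, fun m hm n hn => ?_⟩
    have h1 := hN m hm n hn
    rw [dist_eq_norm, ← map_sub, ← map_sub] at h1
    rw [dist_eq_norm, ← map_sub]
    exact lt_of_mul_lt_mul_left ((norm_schwartzToL2_le _).trans_lt h1) hB.le
  obtain ⟨v, hv⟩ := cauchySeq_tendsto_of_complete hc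
  have hvu : v = u := by
    refine sub_eq_zero.1 (eq_zero_of_orthogonal_range hB _ fun ψ => ?_)
    have h1 : Tendsto (fun m => inner ℂ (schwartzToL2 (landauSchwartz B ψ)) (schwartzToL2 (φ m)))
        atTop (𝓝 (inner ℂ (schwartzToL2 (landauSchwartz B ψ)) v)) := tendsto_const_nhds.inner hv
    have h2 : Tendsto (fun m => inner ℂ (schwartzToL2 ψ) (schwartzToL2 (landauSchwartz B (φ m))))
        atTop (𝓝 (inner ℂ (schwartzToL2 ψ) ((level B q : ℂ) • u))) := tendsto_const_nhds.inner hH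
    have h3 := tendsto_nhds_unique (h1.congr fun m => ip_landauSchwartz B ψ (φ m)) h2
    rw [inner_sub_right, h3, inner_landau_of_mem_levelSpace hu, inner_smul_right, sub_self]
  exact ⟨φ, hvu ▸ hv, hH⟩

theorem re_inner_mulOp (V : Plane → ℝ) (hV : MemLp (fun x => (V x : ℂ)) ∞ (volume : Measure Plane))
    (u : L2) : (inner ℂ u (mulOp V hV u)).re = ∫ x, V x * ‖u x‖ ^ 2 := by
  have h : inner ℂ u (mulOp V hV u) = ∫ x, ((V x * ‖u x‖ ^ 2 : ℝ) : ℂ) := by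
    rw [L2.inner_def]
    refine integral_congr_ae ?_
    filter_upwards [mulOp_ae V hV u] with x hx
    rw [hx, RCLike.inner_apply, mul_assoc, RCLike.mul_conj]
    push_cast
    rfl
  rw [h, integral_complex_ofReal, Complex.ofReal_re]

theorem integrable_mul_norm_sq {V : Plane → ℝ} (hV : AEStronglyMeasurable V volume) {M : ℝ}
    (hM : ∀ x, |V x| ≤ M) (u : L2) : Integrable fun x => V x * ‖u x‖ ^ 2 :=
  ((Lp.memLp u).integrable_norm_pow two_ne_zero).bdd_mul hV
    (Eventually.of_forall fun x => by simpa using hM x)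

theorem integral_norm_sq (u : L2) : ∫ x, ‖u x‖ ^ 2 = ‖u‖ ^ 2 := by
  have h := inner_self_eq_norm_sq_to_K (𝕜 := ℂ) u
  rw [L2.inner_def] at h
  have h2 : ∫ x, inner ℂ (u x) (u x) = ∫ x, ((‖u x‖ ^ 2 : ℝ) : ℂ) := by
    refine integral_congr_ae (Eventually.of_forall fun x => ?_)
    change inner ℂ (u x) (u x) = _
    rw [inner_self_eq_norm_sq_to_K]
    push_cast
    rfl
  rw [h2, integral_complex_ofReal] at h
  refine Complex.ofReal_injective (h.trans ?_)
  push_cast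
  rfl

/-- An eigenfunction of the level `t = λ_q` has mass at most of the order of `R t^{-1/2}` in the
disc of radius `R`. -/
theorem levelSpace_disc_mass_le {B : ℝ} (hB : 0 < B) {q : ℕ} {u : L2} (hu : u ∈ levelSpace B q)
    {R : ℝ} (hR : 0 < R) :
    level B q * ∫ x, weight (dilation R) (-3 / 2) x * ‖u x‖ ^ 2 ≤
      (2 * B * R + 9 / R) * (Real.sqrt (level B q) * ‖u‖ ^ 2) := by
  set t := level B q
  have htp : 0 < t := level_pos hB q
  set W := weight (dilation R) (-3 / 2)
  have hWg : W.HasTemperateGrowth := hasTemperateGrowth_weight _ _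
  have hWm : MemLp (fun x => (W x : ℂ)) ∞ (volume : Measure Plane) :=
    memLp_top_of_bound (hasTemperateGrowth_ofReal_comp hWg).1.continuous.aestronglyMeasurable 1
      (Eventually.of_forall fun x => by
        simpa using abs_weight_le_one (dilation R) (by norm_num) x)
  obtain ⟨φ, h1, h2⟩ := exists_seq_of_mem_levelSpace hB hu
  have hmul : ∀ ψ, mulOp W hWm (schwartzToL2 ψ) = schwartzToL2 (smulR W ψ) := fun ψ => by
    refine Lp.ext ?_
    filter_upwards [mulOp_ae W hWm (schwartzToL2 ψ), coeFn_schwartzToL2 ψ,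
      coeFn_schwartzToL2 (smulR W ψ)] with x a b c
    rw [a, b, c, smulS_apply (hasTemperateGrowth_ofReal_comp hWg)]
  set n := fun m => ‖schwartzToL2 (φ m)‖
  set E := fun m => ‖schwartzToL2 (landauSchwartz B (φ m) - (t : ℂ) • φ m)‖
  set p := fun m => Real.sqrt (ip (landauSchwartz B (φ m)) (φ m)).re
  have hn : Tendsto n atTop (𝓝 ‖u‖) := h1.norm
  have hE : Tendsto E atTop (𝓝 0) := by
    have := (h2.sub (h1.const_smul (t : ℂ))).norm
    rw [sub_self, norm_zero] at this
    refine this.congr fun m => ?_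
    simp only [E, map_sub, map_smul]
  have hp : Tendsto p atTop (𝓝 (Real.sqrt t * ‖u‖)) := by
    have h3 := (Real.continuous_sqrt.tendsto _).comp
      ((Complex.continuous_re.tendsto _).comp (h2.inner (𝕜 := ℂ) h1))
    have h4 : Real.sqrt (inner ℂ ((t : ℂ) • u) u).re = Real.sqrt t * ‖u‖ := by
      rw [inner_smul_left, Complex.conj_ofReal, Complex.re_ofReal_mul]
      have : (inner ℂ u u).re = ‖u‖ ^ 2 := by
        rw [inner_self_eq_norm_sq_to_K]; norm_cast
      rw [this, Real.sqrt_mul htp.le, Real.sqrt_sq (norm_nonneg u)]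
    rw [h4] at h3
    exact h3
  have hpm : ∀ m k, ‖schwartzToL2 (momentum B k (φ m))‖ ≤ p m := fun m k => by
    refine Real.le_sqrt_of_sq_le ?_
    rw [re_ip_landauSchwartz]
    have a := sq_nonneg ‖schwartzToL2 (momentum B 0 (φ m))‖
    have b := sq_nonneg ‖schwartzToL2 (momentum B 1 (φ m))‖
    fin_cases k
    · exact le_add_of_nonneg_right b
    · exact le_add_of_nonneg_left a
  have hfin : ∀ m, t * (inner ℂ (schwartzToL2 (φ m)) (mulOp W hWm (schwartzToL2 (φ m)))).re ≤
      2 * R * (E m * p m) + 2 * (E m * n m) + (2 * B * R + 9 / R) * (p m * n m) := fun m => by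
    rw [hmul]
    exact disc_mass_le hB hR (norm_nonneg _) (Real.sqrt_nonneg _) le_rfl (hpm m) le_rfl
  have hl : Tendsto (fun m => t *
      (inner ℂ (schwartzToL2 (φ m)) (mulOp W hWm (schwartzToL2 (φ m)))).re) atTop
      (𝓝 (t * (inner ℂ u (mulOp W hWm u)).re)) :=
    ((Complex.continuous_re.tendsto _).comp
      (h1.inner (((mulOp W hWm).continuous.tendsto u).comp h1))).const_mul t
  have hr : Tendsto (fun m => 2 * R * (E m * p m) + 2 * (E m * n m) +
      (2 * B * R + 9 / R) * (p m * n m)) atTop (𝓝 (2 * R * (0 * (Real.sqrt t * ‖u‖)) +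
        2 * (0 * ‖u‖) + (2 * B * R + 9 / R) * (Real.sqrt t * ‖u‖ * ‖u‖))) :=
    (((hE.mul hp).const_mul _).add ((hE.mul hn).const_mul _)).add ((hp.mul hn).const_mul _)
  have := le_of_tendsto_of_tendsto' hl hr hfin
  rw [re_inner_mulOp] at this
  calc _ ≤ _ := this
    _ = _ := by ring

/-! ### The dyadic summation and the Berezin–Toeplitz operator -/

theorem one_le_bracket (x : Plane) : 1 ≤ bracket x :=
  Real.one_le_sqrt.2 (by nlinarith [sq_nonneg ‖x‖])

theorem continuous_bracket_rpow (s : ℝ) : Continuous fun x => bracket x ^ s := by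
  refine Continuous.rpow_const ?_ fun x => Or.inl (by linarith [one_le_bracket x])
  unfold bracket
  fun_prop

/-- The weight is at least `2^{-3/2} ≥ 1/3` on the disc of radius `R`. -/
theorem one_le_three_mul_weight {R : ℝ} (hR : 0 < R) {x : Plane} (hx : ‖x‖ ≤ R) :
    1 ≤ 3 * weight (dilation R) (-3 / 2) x := by
  have h1 : ‖dilation R x‖ ≤ 1 := by
    have : dilation R x = R⁻¹ • x := rfl
    rw [this, norm_smul, Real.norm_of_nonneg (by positivity), inv_mul_le_iff₀ hR]
    linarith
  have h2 : (2 : ℝ) ^ (-3 / 2 : ℝ) ≤ weight (dilation R) (-3 / 2) x := by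
    refine Real.rpow_le_rpow_of_nonpos (by positivity) ?_ (by norm_num)
    nlinarith [norm_nonneg (dilation R x)]
  have h3 : (1 / 3 : ℝ) ≤ (2 : ℝ) ^ (-3 / 2 : ℝ) := by
    rw [neg_div, Real.rpow_neg (by norm_num), one_div]
    refine inv_anti₀ (by positivity) ?_
    have h4 : ((2 : ℝ) ^ (3 / 2 : ℝ)) ^ 2 = 8 := by
      rw [← Real.rpow_natCast, ← Real.rpow_mul (by norm_num)]
      norm_num
    nlinarith [Real.rpow_pos_of_pos (show (0 : ℝ) < 2 by norm_num) (3 / 2)]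
  linarith

/-- Dyadic majorant of the weight `⟨x⟩^{-ρ}`. -/
theorem bracket_rpow_le {ρ : ℝ} (hρ : 0 < ρ) (N : ℕ) (x : Plane) :
    bracket x ^ (-ρ) ≤ ((2 : ℝ) ^ N) ^ (-ρ) + ∑ k ∈ Finset.range N,
      ((2 : ℝ) ^ k) ^ (-ρ) * (3 * weight (dilation (2 ^ (k + 1))) (-3 / 2) x) := by
  induction N with
  | zero => simpa using Real.rpow_le_one_of_one_le_of_nonpos (one_le_bracket x) (by linarith)
  | succ N ih =>
    rw [Finset.sum_range_succ]
    have hpos : ∀ k : ℕ, 0 ≤ ((2 : ℝ) ^ k) ^ (-ρ) *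
        (3 * weight (dilation (2 ^ (k + 1))) (-3 / 2) x) := fun k => by
      have := weight_pos (dilation (2 ^ (k + 1))) (-3 / 2) x
      positivity
    have hs := Finset.sum_nonneg fun k (_ : k ∈ Finset.range N) => hpos k
    rcases le_total ‖x‖ (2 ^ (N + 1)) with h | h
    · have h1 := one_le_three_mul_weight (by positivity) h
      have h2 : ((2 : ℝ) ^ N) ^ (-ρ) ≤ ((2 : ℝ) ^ N) ^ (-ρ) *
          (3 * weight (dilation (2 ^ (N + 1))) (-3 / 2) x) :=
        le_mul_of_one_le_right (by positivity) h1
      have h3 : 0 ≤ ((2 : ℝ) ^ (N + 1)) ^ (-ρ) := by positivity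
      linarith
    · have h1 : (2 : ℝ) ^ (N + 1) ≤ bracket x :=
        h.trans (Real.le_sqrt_of_sq_le (by linarith))
      have h2 : bracket x ^ (-ρ) ≤ ((2 : ℝ) ^ (N + 1)) ^ (-ρ) :=
        Real.rpow_le_rpow_of_nonpos (by positivity) h1 (by linarith)
      have h3 := hpos N
      linarith

/-- The dyadic bound, at scale `2^N`, of the mass of an eigenfunction of level `t` weighted by
`⟨x⟩^{-ρ}`. -/
def dyadicBound (B ρ t : ℝ) (N : ℕ) : ℝ :=
  ((2 : ℝ) ^ N) ^ (-ρ) + 6 * (2 * B + 9) * (t ^ (-(1 / 2) : ℝ) *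
    ∑ k ∈ Finset.range N, ((2 : ℝ) ^ (1 - ρ)) ^ k)

theorem dyadicBound_nonneg {B ρ t : ℝ} (hB : 0 < B) (ht : 0 < t) (N : ℕ) :
    0 ≤ dyadicBound B ρ t N := by
  unfold dyadicBound; positivity

theorem abs_bracket_rpow_le_one {ρ : ℝ} (hρ : 0 < ρ) (x : Plane) : |bracket x ^ (-ρ)| ≤ 1 := by
  have h := one_le_bracket x
  rw [abs_of_nonneg (Real.rpow_nonneg (by linarith) _)]
  exact Real.rpow_le_one_of_one_le_of_nonpos h (by linarith)

/-- Integrating the dyadic majorant of `⟨x⟩^{-ρ}` against the disc estimate. -/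
theorem levelSpace_weighted_mass_le {B : ℝ} (hB : 0 < B) {q : ℕ} {u : L2}
    (hu : u ∈ levelSpace B q) {ρ : ℝ} (hρ : 0 < ρ) (N : ℕ) :
    ∫ x, bracket x ^ (-ρ) * ‖u x‖ ^ 2 ≤ dyadicBound B ρ (level B q) N * ‖u‖ ^ 2 := by
  set t := level B q
  have ht : 0 < t := level_pos hB q
  have hW : ∀ R : ℝ, Integrable fun x => weight (dilation R) (-3 / 2) x * ‖u x‖ ^ 2 := fun R =>
    integrable_mul_norm_sq (hasTemperateGrowth_weight _ _).1.continuous.aestronglyMeasurable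
      (abs_weight_le_one _ (by norm_num)) u
  have hdisc : ∀ R : ℝ, 1 ≤ R → ∫ x, weight (dilation R) (-3 / 2) x * ‖u x‖ ^ 2 ≤
      (2 * B + 9) * R * t ^ (-(1 / 2) : ℝ) * ‖u‖ ^ 2 := fun R hR => by
    have h := levelSpace_disc_mass_le hB hu (R := R) (by linarith)
    have h1 : 2 * B * R + 9 / R ≤ (2 * B + 9) * R := by
      have : 9 / R ≤ 9 * R := by
        rw [div_le_iff₀ (by linarith)]; nlinarith
      linarith
    have h2 : t * t ^ (-(1 / 2) : ℝ) = Real.sqrt t := by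
      rw [Real.sqrt_eq_rpow]
      nth_rewrite 1 [← Real.rpow_one t]
      rw [← Real.rpow_add ht]
      norm_num
    refine le_of_mul_le_mul_left ?_ ht
    calc _ ≤ _ := h
      _ ≤ (2 * B + 9) * R * (Real.sqrt t * ‖u‖ ^ 2) := by gcongr
      _ = _ := by rw [← h2]; ring
  have hint0 : Integrable fun x => ‖u x‖ ^ 2 := (Lp.memLp u).integrable_norm_pow two_ne_zero
  have hle : ∫ x, bracket x ^ (-ρ) * ‖u x‖ ^ 2 ≤ ∫ x, (((2 : ℝ) ^ N) ^ (-ρ) * ‖u x‖ ^ 2 +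
      ∑ k ∈ Finset.range N, ((2 : ℝ) ^ k) ^ (-ρ) * 3 *
        (weight (dilation (2 ^ (k + 1))) (-3 / 2) x * ‖u x‖ ^ 2)) := by
    refine integral_mono (integrable_mul_norm_sq
      (continuous_bracket_rpow _).aestronglyMeasurable (abs_bracket_rpow_le_one hρ) u) ?_ ?_
    · exact (hint0.const_mul _).add (integrable_finsetSum _ fun k _ => (hW _).const_mul _)
    · intro x
      have := mul_le_mul_of_nonneg_right (bracket_rpow_le hρ N x) (sq_nonneg ‖u x‖)
      rw [add_mul, Finset.sum_mul] at this
      refine this.trans (le_of_eq ?_)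
      congr 1
      exact Finset.sum_congr rfl fun k _ => by ring
  rw [integral_add (hint0.const_mul _) (integrable_finsetSum _ fun k _ => (hW _).const_mul _),
    integral_finsetSum _ fun k _ => (hW _).const_mul _, integral_const_mul, integral_norm_sq] at hle
  simp_rw [integral_const_mul] at hle
  refine hle.trans ?_
  rw [dyadicBound, add_mul, Finset.mul_sum, Finset.mul_sum, Finset.sum_mul]
  refine add_le_add le_rfl (Finset.sum_le_sum fun k _ => ?_)
  calc ((2 : ℝ) ^ k) ^ (-ρ) * 3 * ∫ x, weight (dilation (2 ^ (k + 1))) (-3 / 2) x * ‖u x‖ ^ 2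
      ≤ ((2 : ℝ) ^ k) ^ (-ρ) * 3 * ((2 * B + 9) * 2 ^ (k + 1) * t ^ (-(1 / 2) : ℝ) * ‖u‖ ^ 2) := by
        gcongr
        exact hdisc _ (one_le_pow₀ (by norm_num))
    _ = _ := by
      have h1 : ((2 : ℝ) ^ (1 - ρ)) ^ k = 2 ^ k * ((2 : ℝ) ^ k) ^ (-ρ) := by
        rw [← Real.rpow_natCast, ← Real.rpow_natCast, ← Real.rpow_mul (by norm_num),
          ← Real.rpow_mul (by norm_num), ← Real.rpow_add (by norm_num)]
        congr 1
        ring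
      rw [h1]
      ring

/-- A bound on the weighted mass of the eigenfunctions bounds the Berezin–Toeplitz operator. -/
theorem norm_toeplitz_le {B : ℝ} {q : ℕ} {ρ : ℝ} (hρ : 0 < ρ) {V : Plane → ℝ}
    (hV : Measurable V) {c : ℝ} (hdecay : ∀ x, |V x| ≤ c * bracket x ^ (-ρ)) {M : ℝ} (hM : 0 ≤ M)
    (hmass : ∀ u ∈ levelSpace B q, ∫ x, bracket x ^ (-ρ) * ‖u x‖ ^ 2 ≤ M * ‖u‖ ^ 2) :
    ‖toeplitz B q V (memLp_top_of_decay hV hρ hdecay)‖ ≤ c * M := by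
  have hbr : ∀ x, 0 < bracket x ^ (-ρ) := fun x =>
    Real.rpow_pos_of_pos (by linarith [one_le_bracket x]) _
  have hc : 0 ≤ c := nonneg_of_mul_nonneg_left ((abs_nonneg _).trans (hdecay 0)) (hbr 0)
  set hV' := memLp_top_of_decay hV hρ hdecay
  have hI : ∀ u : L2, Integrable fun x => bracket x ^ (-ρ) * ‖u x‖ ^ 2 := fun u =>
    integrable_mul_norm_sq (continuous_bracket_rpow _).aestronglyMeasurable
      (abs_bracket_rpow_le_one hρ) u
  have hform : ∀ y ∈ levelSpace B q, ∀ v ∈ levelSpace B q,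
      ‖inner ℂ y (mulOp V hV' v)‖ ≤ c * M * (‖y‖ * ‖v‖) := by
    intro y hy v hv
    rcases eq_or_ne y 0 with rfl | hy0
    · simp
    rcases eq_or_ne v 0 with rfl | hv0
    · simp
    have hyn := norm_pos_iff.2 hy0
    have hvn := norm_pos_iff.2 hv0
    -- the weight that balances the two halves of the arithmetic-geometric mean inequality
    set s := ‖v‖ / ‖y‖ with hs
    have hsp : 0 < s := by positivity
    rw [L2.inner_def]
    have h1 : ‖∫ x, inner ℂ (y x) (mulOp V hV' v x)‖ ≤
        ∫ x, c * (s / 2 * (bracket x ^ (-ρ) * ‖y x‖ ^ 2) +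
          1 / (2 * s) * (bracket x ^ (-ρ) * ‖v x‖ ^ 2)) := by
      refine norm_integral_le_of_norm_le
        ((((hI y).const_mul _).add ((hI v).const_mul _)).const_mul _) ?_
      filter_upwards [mulOp_ae V hV' v] with x hx
      rw [hx]
      have h2 : ‖inner ℂ (y x) ((V x : ℂ) * v x)‖ = |V x| * (‖y x‖ * ‖v x‖) := by
        rw [RCLike.inner_apply, norm_mul, norm_mul, RCLike.norm_conj, Complex.norm_real,
          Real.norm_eq_abs]
        ring
      rw [h2]
      have h3 : ‖y x‖ * ‖v x‖ ≤ s / 2 * ‖y x‖ ^ 2 + 1 / (2 * s) * ‖v x‖ ^ 2 := by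
        have h4 : 0 ≤ (s * ‖y x‖ - ‖v x‖) ^ 2 / (2 * s) := by positivity
        have h5 : (s * ‖y x‖ - ‖v x‖) ^ 2 / (2 * s) =
            s / 2 * ‖y x‖ ^ 2 + 1 / (2 * s) * ‖v x‖ ^ 2 - ‖y x‖ * ‖v x‖ := by
          field_simp
          ring
        linarith
      calc |V x| * (‖y x‖ * ‖v x‖)
          ≤ (c * bracket x ^ (-ρ)) * (s / 2 * ‖y x‖ ^ 2 + 1 / (2 * s) * ‖v x‖ ^ 2) :=
            mul_le_mul (hdecay x) h3 (by positivity) (mul_nonneg hc (hbr x).le)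
        _ = _ := by ring
    refine h1.trans ?_
    rw [integral_const_mul, integral_add ((hI y).const_mul _) ((hI v).const_mul _),
      integral_const_mul, integral_const_mul, mul_assoc]
    refine mul_le_mul_of_nonneg_left ?_ hc
    calc _ ≤ s / 2 * (M * ‖y‖ ^ 2) + 1 / (2 * s) * (M * ‖v‖ ^ 2) := by
          gcongr
          · exact hmass y hy
          · exact hmass v hv
      _ = _ := by rw [hs]; field_simp; ring
  refine ContinuousLinearMap.opNorm_le_bound _ (mul_nonneg hc hM) fun u => ?_
  set v := levelProj B q u
  have hvm : v ∈ levelSpace B q := Submodule.starProjection_apply_mem _ u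
  have hvn : ‖v‖ ≤ ‖u‖ := Submodule.norm_starProjection_apply_le _ u
  set y := levelProj B q (mulOp V hV' v)
  have hym : y ∈ levelSpace B q := Submodule.starProjection_apply_mem _ _
  change ‖y‖ ≤ c * M * ‖u‖
  have h1 : inner ℂ y (mulOp V hV' v) = inner ℂ y y := by
    have h2 : levelProj B q y = y := Submodule.starProjection_eq_self_iff.2 hym
    nth_rewrite 1 [← h2]
    exact Submodule.inner_starProjection_left_eq_right _ _ _
  have h3 := hform y hym v hvm
  have h4 : ‖inner ℂ y y‖ = ‖y‖ ^ 2 := by rw [inner_self_eq_norm_sq_to_K]; simp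
  rw [h1, h4] at h3
  rcases eq_or_ne y 0 with h0 | h0
  · rw [h0, norm_zero]; positivity
  · refine le_of_mul_le_mul_left ?_ (norm_pos_iff.2 h0)
    calc ‖y‖ * ‖y‖ ≤ c * M * (‖y‖ * ‖v‖) := by nlinarith
      _ ≤ c * M * (‖y‖ * ‖u‖) := by gcongr
      _ = _ := by ring

/-- A power of `2` comparable with `√t`, or `2^0` if `√t ≤ 1`. -/
theorem exists_dyadic_scale (t : ℝ) : ∃ N : ℕ, Real.sqrt t ≤ 2 ^ N ∧
    (N = 0 ∨ (2 : ℝ) ^ N ≤ 2 * Real.sqrt t) := by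
  have hex : ∃ N : ℕ, Real.sqrt t ≤ 2 ^ N := by
    obtain ⟨N, hN⟩ := pow_unbounded_of_one_lt (Real.sqrt t) (one_lt_two)
    exact ⟨N, hN.le⟩
  classical
  refine ⟨Nat.find hex, Nat.find_spec hex, ?_⟩
  rcases Nat.eq_zero_or_pos (Nat.find hex) with h | h
  · exact Or.inl h
  · right
    have h1 := Nat.find_min hex (Nat.sub_lt h one_pos)
    have h2 : Nat.find hex = (Nat.find hex - 1) + 1 := by omega
    rw [h2, pow_succ]
    linarith [not_le.1 h1]

theorem sqrt_rpow_neg {t : ℝ} (ht : 0 ≤ t) (ρ : ℝ) : Real.sqrt t ^ (-ρ) = t ^ (-ρ / 2) := by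
  rw [Real.sqrt_eq_rpow, ← Real.rpow_mul ht]
  congr 1
  ring

theorem two_pow_rpow_neg_le {t ρ : ℝ} (ht : 0 < t) (hρ : 0 < ρ) {N : ℕ}
    (hN : Real.sqrt t ≤ 2 ^ N) : ((2 : ℝ) ^ N) ^ (-ρ) ≤ t ^ (-ρ / 2) := by
  rw [← sqrt_rpow_neg ht.le]
  exact Real.rpow_le_rpow_of_nonpos (Real.sqrt_pos.2 ht) hN (by linarith)

theorem dyadicBound_le_of_lt_one {B ρ : ℝ} (hB : 0 < B) (hρ : 0 < ρ) (hρ1 : ρ < 1) :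
    ∃ C, ∀ t, 0 < t → ∃ N, dyadicBound B ρ t N ≤ C * t ^ (-ρ / 2) := by
  set r : ℝ := 2 ^ (1 - ρ) with hr
  have hr1 : 1 < r := Real.one_lt_rpow (by norm_num) (by linarith)
  have hr0 : 0 < r - 1 := by linarith
  refine ⟨1 + 6 * (2 * B + 9) * (r / (r - 1)), fun t ht => ?_⟩
  obtain ⟨N, h1, h2⟩ := exists_dyadic_scale t
  refine ⟨N, ?_⟩
  have hsum : t ^ (-(1 / 2) : ℝ) * ∑ k ∈ Finset.range N, r ^ k ≤ r / (r - 1) * t ^ (-ρ / 2) := by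
    rcases h2 with rfl | h2
    · simp only [Finset.range_zero, Finset.sum_empty, mul_zero]; positivity
    · have h3 : r ^ N ≤ r * Real.sqrt t ^ (1 - ρ) := by
        have : r ^ N = ((2 : ℝ) ^ N) ^ (1 - ρ) := by
          rw [hr, ← Real.rpow_natCast, ← Real.rpow_natCast, ← Real.rpow_mul (by norm_num),
            ← Real.rpow_mul (by norm_num), mul_comm]
        rw [this, hr, ← Real.mul_rpow (by norm_num) (Real.sqrt_nonneg t)]
        exact Real.rpow_le_rpow (by positivity) h2 (by linarith)
      have h4 : t ^ (-(1 / 2) : ℝ) * Real.sqrt t ^ (1 - ρ) = t ^ (-ρ / 2) := by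
        rw [Real.sqrt_eq_rpow, ← Real.rpow_mul ht.le, ← Real.rpow_add ht]
        congr 1
        ring
      rw [geom_sum_eq hr1.ne']
      calc t ^ (-(1 / 2) : ℝ) * ((r ^ N - 1) / (r - 1))
          ≤ t ^ (-(1 / 2) : ℝ) * ((r * Real.sqrt t ^ (1 - ρ)) / (r - 1)) := by
            gcongr; linarith
        _ = _ := by rw [← h4]; ring
  calc dyadicBound B ρ t N
      ≤ t ^ (-ρ / 2) + 6 * (2 * B + 9) * (r / (r - 1) * t ^ (-ρ / 2)) :=
        add_le_add (two_pow_rpow_neg_le ht hρ h1) (mul_le_mul_of_nonneg_left hsum (by positivity))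
    _ = _ := by ring

theorem dyadicBound_le_of_eq_one {B : ℝ} (hB : 0 < B) {t : ℝ} (ht : 0 < t) :
    ∃ N, dyadicBound B 1 t N ≤
      t ^ (-(1 / 2) : ℝ) * (1 + 6 * (2 * B + 9) * (1 + |Real.log t|)) := by
  obtain ⟨N, h1, h2⟩ := exists_dyadic_scale t
  refine ⟨N, ?_⟩
  have hN : (N : ℝ) ≤ 1 + |Real.log t| := by
    rcases h2 with rfl | h2
    · simp only [Nat.cast_zero]; positivity
    · have h3 := Real.log_le_log (by positivity) h2
      rw [Real.log_pow, Real.log_mul (by norm_num) (Real.sqrt_pos.2 ht).ne',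
        Real.log_sqrt ht.le] at h3
      have h4 := le_abs_self (Real.log t)
      have h5 := Real.log_two_gt_d9
      have h6 : (N : ℝ) * Real.log 2 ≤ (1 + |Real.log t|) * Real.log 2 := by
        nlinarith [abs_nonneg (Real.log t)]
      exact le_of_mul_le_mul_right h6 (by linarith)
  have hs : ∑ k ∈ Finset.range N, ((2 : ℝ) ^ ((1 : ℝ) - 1)) ^ k = N := by simp
  have h7 := two_pow_rpow_neg_le ht one_pos h1
  rw [dyadicBound, hs]
  have e : (-1 / 2 : ℝ) = -(1 / 2) := by norm_num
  rw [e] at h7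
  calc _ ≤ t ^ (-(1 / 2) : ℝ) +
        6 * (2 * B + 9) * (t ^ (-(1 / 2) : ℝ) * (1 + |Real.log t|)) := by gcongr
    _ = _ := by ring

theorem dyadicBound_le_of_one_lt {B ρ : ℝ} (hB : 0 < B) (hρ1 : 1 < ρ) :
    ∃ C, ∀ t, B ≤ t → ∃ N, dyadicBound B ρ t N ≤ C * t ^ (-(1 / 2) : ℝ) := by
  set r : ℝ := 2 ^ (1 - ρ) with hr
  have hr0 : 0 < r := by positivity
  have hr1 : r < 1 := Real.rpow_lt_one_of_one_lt_of_neg (by norm_num) (by linarith)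
  refine ⟨B ^ (-(ρ - 1) / 2) + 6 * (2 * B + 9) * (1 - r)⁻¹, fun t ht => ?_⟩
  have ht0 : 0 < t := hB.trans_le ht
  obtain ⟨N, h1, -⟩ := exists_dyadic_scale t
  refine ⟨N, ?_⟩
  have hsum : ∑ k ∈ Finset.range N, r ^ k ≤ (1 - r)⁻¹ := by
    rw [← tsum_geometric_of_lt_one hr0.le hr1]
    exact (summable_geometric_of_lt_one hr0.le hr1).sum_le_tsum _ fun k _ => by positivity
  have h2 : t ^ (-ρ / 2) ≤ B ^ (-(ρ - 1) / 2) * t ^ (-(1 / 2) : ℝ) := by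
    have : t ^ (-ρ / 2) = t ^ (-(ρ - 1) / 2) * t ^ (-(1 / 2) : ℝ) := by
      rw [← Real.rpow_add ht0]; congr 1; ring
    rw [this]
    exact mul_le_mul_of_nonneg_right (Real.rpow_le_rpow_of_nonpos hB ht (by linarith))
      (by positivity)
  calc dyadicBound B ρ t N
      ≤ B ^ (-(ρ - 1) / 2) * t ^ (-(1 / 2) : ℝ) +
          6 * (2 * B + 9) * (t ^ (-(1 / 2) : ℝ) * (1 - r)⁻¹) := by
        refine add_le_add ((two_pow_rpow_neg_le ht0 (by linarith) h1).trans h2) ?_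
        gcongr
    _ = _ := by ring

/-- The numbers `|log λ_q|`, when they do not vanish, are bounded away from zero, because the
levels tend to infinity. -/
theorem exists_one_le_mul_abs_log_level {B : ℝ} (hB : 0 < B) :
    ∃ D, ∀ q, level B q ≠ 1 → 1 ≤ D * |Real.log (level B q)| := by
  have hlim : Tendsto (fun q => (|Real.log (level B q)|)⁻¹) atTop (𝓝 0) := by
    refine tendsto_inv_atTop_zero.comp (tendsto_abs_atTop_atTop.comp
      (Real.tendsto_log_atTop.comp ?_))
    exact (tendsto_atTop_add_const_right _ _
      (tendsto_natCast_atTop_atTop.const_mul_atTop two_pos)).const_mul_atTop hB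
  obtain ⟨D, hD⟩ := hlim.bddAbove_range
  refine ⟨D, fun q hq => ?_⟩
  have hlog : Real.log (level B q) ≠ 0 :=
    Real.log_ne_zero_of_pos_of_ne_one (level_pos hB q) hq
  have h := hD ⟨q, rfl⟩
  rwa [inv_le_iff_one_le_mul₀ (abs_pos.2 hlog)] at h

end Landau

end

theorem proposition3p6 (B : ℝ) (hB : 0 < B) (ρ : ℝ) (hρ : 0 < ρ)
    (V : Landau.Plane → ℝ) (hV : Measurable V) (c : ℝ)
    (hdecay : ∀ x, |V x| ≤ c * Landau.bracket x ^ (-ρ)) :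
    ∃ C : ℝ, ∀ q : ℕ,
      (ρ < 1 →
        ‖Landau.toeplitz B q V (Landau.memLp_top_of_decay hV hρ hdecay)‖
          ≤ C * Landau.level B q ^ (-ρ / 2)) ∧
      (ρ = 1 → Landau.level B q ≠ 1 →
        ‖Landau.toeplitz B q V (Landau.memLp_top_of_decay hV hρ hdecay)‖
          ≤ C * (Landau.level B q ^ (-(1 / 2) : ℝ) * |Real.log (Landau.level B q)|)) ∧
      (1 < ρ →
        ‖Landau.toeplitz B q V (Landau.memLp_top_of_decay hV hρ hdecay)‖
          ≤ C * Landau.level B q ^ (-(1 / 2) : ℝ)) := by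
  have hc : 0 ≤ c := nonneg_of_mul_nonneg_left ((abs_nonneg _).trans (hdecay 0))
    (Real.rpow_pos_of_pos (by linarith [Landau.one_le_bracket 0]) _)
  have key : ∀ q N, ‖Landau.toeplitz B q V (Landau.memLp_top_of_decay hV hρ hdecay)‖ ≤
      c * Landau.dyadicBound B ρ (Landau.level B q) N := fun q N =>
    Landau.norm_toeplitz_le hρ hV hdecay
      (Landau.dyadicBound_nonneg hB (Landau.level_pos hB q) N)
      fun u hu => Landau.levelSpace_weighted_mass_le hB hu hρ N
  rcases lt_trichotomy ρ 1 with h | h | h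
  · obtain ⟨C, hC⟩ := Landau.dyadicBound_le_of_lt_one hB hρ h
    refine ⟨c * C, fun q => ⟨fun _ => ?_, fun h' => absurd h' h.ne, fun h' => absurd h' h.not_gt⟩⟩
    obtain ⟨N, hN⟩ := hC _ (Landau.level_pos hB q)
    rw [mul_assoc]
    exact (key q N).trans (mul_le_mul_of_nonneg_left hN hc)
  · obtain ⟨D, hD⟩ := Landau.exists_one_le_mul_abs_log_level hB
    set K := 6 * (2 * B + 9)
    have hKp : 0 < K := by positivity
    refine ⟨c * (D + K * (D + 1)), fun q =>
      ⟨fun h' => absurd h h'.ne, fun _ hq => ?_, fun h' => absurd h h'.ne'⟩⟩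
    obtain ⟨N, hN⟩ := Landau.dyadicBound_le_of_eq_one hB (Landau.level_pos hB q)
    have hk := key q N
    have hb : Landau.dyadicBound B ρ (Landau.level B q) N =
        Landau.dyadicBound B 1 (Landau.level B q) N := by rw [h]
    rw [hb] at hk
    rw [mul_assoc]
    refine hk.trans (mul_le_mul_of_nonneg_left (hN.trans ?_) hc)
    have hpos := Real.rpow_pos_of_pos (Landau.level_pos hB q) (-(1 / 2) : ℝ)
    have hD' := hD q hq
    calc Landau.level B q ^ (-(1 / 2) : ℝ) * (1 + K * (1 + |Real.log (Landau.level B q)|))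
        ≤ Landau.level B q ^ (-(1 / 2) : ℝ) * (D * |Real.log (Landau.level B q)| +
          K * (D * |Real.log (Landau.level B q)| + |Real.log (Landau.level B q)|)) := by gcongr
      _ = _ := by ring
  · obtain ⟨C, hC⟩ := Landau.dyadicBound_le_of_one_lt hB h
    refine ⟨c * C, fun q => ⟨fun h' => absurd h' h.not_gt, fun h' => absurd h' h.ne', fun _ => ?_⟩⟩
    have hBq : B ≤ Landau.level B q := by
      have : (0 : ℝ) ≤ q := Nat.cast_nonneg q
      unfold Landau.level
      nlinarith
    obtain ⟨N, hN⟩ := hC _ hBq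
    rw [mul_assoc]
    exact (key q N).trans (mul_le_mul_of_nonneg_left hN hc)
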